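/- Let $F:[0,\infty]^4\to[0,\infty]$ be weakly increasing for the product order, with $x l_y+y l_x\le F(x,y,l_x,l_y)$ for all $x,y,l_x,l_y\in[0,\infty)$, and with $F(x,y,l_x,l_y)<\infty$ whenever $x,y,l_x,l_y<\infty$. An $F$-quasi-Leibniz quantum compact metric space $(\mathfrak A,\mathsf L)$ is a nonzero unital C*-algebra $\mathfrak A$ with a seminorm $\mathsf L$ defined on a dense Jordan–Lie subalgebra $\mathrm{dom}(\mathsf L)$ of the self-adjoint part $\mathfrak{sa}(\mathfrak A)$ (extended by $\mathsf L=\infty$ elsewhere on $\mathfrak{sa}(\mathfrak A)$) such that: $\{a:\mathsf L(a)=0\}=\mathbb R 1_{\mathfrak A}$; the Monge–Kantorovich metric $\mathsf{mk}_{\mathsf L}(\varphi,\psi)=\sup\{|\varphi(a)-\psi(a)|:\mathsf L(a)\le 1\}$ metrizes the weak* topology of the state space $\mathscr S(\mathfrak A)$; $\max\{\mathsf L(\tfrac{ab+ba}{2}),\mathsf L(\tfrac{ab-ba}{2i})\}\le F(\|a\|,\|b\|,\mathsf L(a),\mathsf L(b))$ for $a,b\in\mathrm{dom}(\mathsf L)$;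 and $\mathsf L$ is lower semicontinuous for the norm. A quantum isometry $\pi:(\mathfrak D,\mathsf L_{\mathfrak D})\to(\mathfrak A,\mathsf L_{\mathfrak A})$ is a surjective *-homomorphism such that $\mathsf L_{\mathfrak A}(b)=\inf\{\mathsf L_{\mathfrak D}(d):d\in\mathfrak{sa}(\mathfrak D),\ \pi(d)=b\}$ for all $b\in\mathfrak{sa}(\mathfrak A)$. An $F$-tunnel from $(\mathfrak A_1,\mathsf L_1)$ to $(\mathfrak A_2,\mathsf L_2)$ is an $F$-quasi-Leibniz quantum compact metric space $(\mathfrak D,\mathsf L_{\mathfrak D})$ with quantum isometries $\pi_j:(\mathfrak D,\mathsf L_{\mathfrak D})\to(\mathfrak A_j,\mathsf L_j)$, $j=1,2$; its extent is the maximum over $j\in\{1,2\}$ of the Hausdorff distance, for $\mathsf{mk}_{\mathsf L_{\mathfrak D}}$, between $\mathscr S(\mathfrak D)$ and $\{\varphi\circ\pi_j:\varphi\in\mathscr S(\mathfrak A_j)\}$. The dual propinquity $\Lambda^*_F$ between two such spaces is the infimum of the extents of all $F$-tunnels between them. Let $G$ be a compact group with unit $e$ and let $\ell:G\to[0,\infty)$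 be a continuous length function (that is, $\ell(g)=0$ if and only if $g=e$, $\ell(g^{-1})=\ell(g)$ and $\ell(gh)\le\ell(g)+\ell(h)$ for all $g,h\in G$) such that $\ell(hgh^{-1})=\ell(g)$ for all $g,h\in G$. Let $\mathscr G$ be a nonempty collection of closed subgroups of $G$ which is closed for the Hausdorff distance, on closed subsets of $G$, induced by the distance $(g,h)\mapsto\ell(h^{-1}g)$. Let $\mathcal C$ be the class of all $F$-quasi-Leibniz quantum compact metric spaces $(\mathfrak A,\mathsf L)$ for which there exist $H\in\mathscr G$ and a strongly continuous ergodic action $\alpha$ of $H$ on $\mathfrak A$ by *-automorphisms (ergodic: $\{a\in\mathfrak A:\alpha^h(a)=a\ \text{for all}\ h\in H\}=\mathbb C1_{\mathfrak A}$) such that 1. for all $a\in\mathfrak{sa}(\mathfrak A)$, $\displaystyle \mathsf L(a)\ge\sup\left\{\frac{\|a-\alpha^h(a)\|_{\mathfrak A}}{\ell(h)}:h\in H\setminus\{e\}\right\}$ (the supremum of the empty set being $0$); 2. for all $h\in H$ and $a\in\mathfrak{sa}(\mathfrak A)$, $\mathsf L(\alpha^h(a))\le\mathsf L(a)$. Then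 $\mathcal C$ is nonempty, and $\mathcal C$ is closed for the dual propinquity: if $(\mathfrak A_n,\mathsf L_n)_{n\in\mathbb N}$ is a sequence in $\mathcal C$ and $(\mathfrak B,\mathsf L_{\mathfrak B})$ is an $F$-quasi-Leibniz quantum compact metric space with $\lim_{n\to\infty}\Lambda^*_F((\mathfrak A_n,\mathsf L_n),(\mathfrak B,\mathsf L_{\mathfrak B}))=0$, then $(\mathfrak B,\mathsf L_{\mathfrak B})\in\mathcal C$. -/

import Mathlib

open scoped ENNReal NNReal ComplexOrder Topology CStarAlgebra

universe u

noncomputable section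

namespace Propinquity

/-! ### Hausdorff distance -/

/-- The Hausdorff (extended) distance between two sets, for an explicitly given distance function. -/
def hausdorffDist {X : Type*} (d : X → X → ℝ≥0∞) (S T : Set X) : ℝ≥0∞ :=
  max (⨆ x ∈ S, ⨅ y ∈ T, d x y) (⨆ y ∈ T, ⨅ x ∈ S, d y x)

theorem hausdorffDist_edist {X : Type*} [PseudoEMetricSpace X] (S T : Set X) :
    hausdorffDist (fun x y : X => edist x y) S T = Metric.hausdorffEDist S T := by
  rw [Metric.hausdorffEDist_def]
  rfl

/-! ### Length functions on groups -/

/-- Length functions on a group, with values in `[0, ∞)`. -/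
structure IsLengthFunction {G : Type*} [Group G] (ℓ : G → ℝ≥0) : Prop where
  eq_zero_iff : ∀ g, ℓ g = 0 ↔ g = 1
  inv : ∀ g, ℓ g⁻¹ = ℓ g
  mul_le : ∀ g h, ℓ (g * h) ≤ ℓ g + ℓ h

/-- The distance `ℓ (h⁻¹ g)` on a group induced by a length function. -/
def lengthDist {G : Type*} [Group G] (ℓ : G → ℝ≥0) (g h : G) : ℝ≥0∞ := (ℓ (h⁻¹ * g) : ℝ≥0∞)

/-- A family of subgroups is closed for the Hausdorff distance: any closed subset of the group
which is a limit, for the Hausdorff distance induced by `ℓ`, of a sequence in the family is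
(the underlying set of) a member of the family. -/
def IsHausdorffClosed {G : Type*} [Group G] [TopologicalSpace G] (ℓ : G → ℝ≥0)
    (𝒢 : Set (Subgroup G)) : Prop :=
  ∀ (K : Set G) (H : ℕ → Subgroup G), IsClosed K → (∀ n, H n ∈ 𝒢) →
    Filter.Tendsto (fun n => hausdorffDist (lengthDist ℓ) (H n : Set G) K) Filter.atTop (𝓝 0) →
    ∃ H' ∈ 𝒢, (H' : Set G) = K

/-! ### Quasi-Leibniz quantum compact metric spaces -/

/-- Admissible functions `F : [0, ∞]⁴ → [0, ∞]`. -/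
structure IsAdmissible (F : ℝ≥0∞ → ℝ≥0∞ → ℝ≥0∞ → ℝ≥0∞ → ℝ≥0∞) : Prop where
  mono : ∀ ⦃x x' y y' s s' t t' : ℝ≥0∞⦄, x ≤ x' → y ≤ y' → s ≤ s' → t ≤ t' →
    F x y s t ≤ F x' y' s' t'
  leibniz_le : ∀ x y s t : ℝ≥0, ((x * t + y * s : ℝ≥0) : ℝ≥0∞) ≤ F x y s t

section CStar

variable (A : Type u) [CStarAlgebra A]

/-- The state space of a unital C*-algebra: positive functionals `φ` with `φ 1 = 1`. As a subset
of the weak dual it carries the weak* topology. -/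
def stateSpace : Set (WeakDual ℂ A) := {φ | φ 1 = 1 ∧ ∀ a : A, 0 ≤ φ (star a * a)}

variable {A}

/-- The Jordan product `(a b + b a) / 2`, i.e. the real part of `a b`. -/
def jordanMul (a b : selfAdjoint A) : selfAdjoint A := realPart (a * b : A)

/-- The Lie product `(a b - b a) / (2 i)`, i.e. the imaginary part of `a b`. -/
def lieMul (a b : selfAdjoint A) : selfAdjoint A := imaginaryPart (a * b : A)

theorem coe_jordanMul (a b : selfAdjoint A) :
    (jordanMul a b : A) = (2 : ℝ)⁻¹ • ((a : A) * b + b * a) := by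
  simp [jordanMul, realPart_apply_coe, a.2.star_eq, b.2.star_eq]

theorem coe_lieMul (a b : selfAdjoint A) :
    (lieMul a b : A) = (2 * Complex.I)⁻¹ • ((a : A) * b - b * a) := by
  simp only [lieMul, imaginaryPart_apply_coe, star_mul, a.2.star_eq, b.2.star_eq]
  rw [← Complex.coe_smul, smul_smul]
  congr 1
  simp [mul_comm]

/-- The Monge–Kantorovich distance between states associated with `L`. -/
def mongeKantorovich (L : selfAdjoint A → ℝ≥0∞) (φ ψ : stateSpace A) : ℝ≥0∞ :=
  ⨆ (a : selfAdjoint A) (_ : L a ≤ 1), ‖φ.1 (a : A) - ψ.1 (a : A)‖ₑ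

/-- `F`-quasi-Leibniz L-seminorms. The seminorm is extended by `∞` outside of its domain, so that
its domain is `{a | L a ≠ ∞}`. -/
structure IsLSeminorm (F : ℝ≥0∞ → ℝ≥0∞ → ℝ≥0∞ → ℝ≥0∞ → ℝ≥0∞)
    (L : selfAdjoint A → ℝ≥0∞) : Prop where
  add_le : ∀ a b, L (a + b) ≤ L a + L b
  smul_eq : ∀ (t : ℝ) (a), L (t • a) = ‖t‖ₑ * L a
  dense_dom : Dense {a | L a ≠ ∞}
  jordan_mem_dom : ∀ a b, L a ≠ ∞ → L b ≠ ∞ → L (jordanMul a b) ≠ ∞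
  lie_mem_dom : ∀ a b, L a ≠ ∞ → L b ≠ ∞ → L (lieMul a b) ≠ ∞
  eq_zero_iff : ∀ a, L a = 0 ↔ ∃ t : ℝ, a = t • (1 : selfAdjoint A)
  /-- The Monge–Kantorovich distance is a metric which induces the weak* topology on states. -/
  metrizes : ∃ m : MetricSpace (stateSpace A),
    m.toUniformSpace.toTopologicalSpace = instTopologicalSpaceSubtype ∧
    ∀ φ ψ : stateSpace A, m.edist φ ψ = mongeKantorovich L φ ψ
  quasi_leibniz : ∀ a b, L a ≠ ∞ → L b ≠ ∞ →
    max (L (jordanMul a b)) (L (lieMul a b)) ≤ F ‖(a : A)‖ₑ ‖(b : A)‖ₑ (L a) (L b)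
  lsc : LowerSemicontinuous L

end CStar

/-- `F`-quasi-Leibniz quantum compact metric spaces: a nonzero unital C*-algebra together with
an `F`-quasi-Leibniz L-seminorm. -/
structure QQCMS (F : ℝ≥0∞ → ℝ≥0∞ → ℝ≥0∞ → ℝ≥0∞ → ℝ≥0∞) where
  carrier : Type u
  [cstar : CStarAlgebra carrier]
  [nontrivial : Nontrivial carrier]
  L : selfAdjoint carrier → ℝ≥0∞
  isLSeminorm : IsLSeminorm F L

attribute [instance] QQCMS.cstar QQCMS.nontrivial

variable {F : ℝ≥0∞ → ℝ≥0∞ → ℝ≥0∞ → ℝ≥0∞ → ℝ≥0∞}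

/-! ### Tunnels and the dual propinquity -/

/-- Quantum isometries: *-epimorphisms such that the L-seminorm of the codomain is the quotient of
the L-seminorm of the domain. -/
structure IsQuantumIsometry (D A : QQCMS.{u} F) (π : D.carrier →⋆ₐ[ℂ] A.carrier) : Prop where
  surjective : Function.Surjective π
  quotient : ∀ b : selfAdjoint A.carrier,
    A.L b = ⨅ (d : selfAdjoint D.carrier) (_ : π (d : D.carrier) = (b : A.carrier)), D.L d

/-- `F`-tunnels from `A` to `B`. -/
structure Tunnel (A B : QQCMS.{u} F) where
  D : QQCMS.{u} F
  π₁ : D.carrier →⋆ₐ[ℂ] A.carrier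
  π₂ : D.carrier →⋆ₐ[ℂ] B.carrier
  isometry₁ : IsQuantumIsometry D A π₁
  isometry₂ : IsQuantumIsometry D B π₂

/-- The map `φ ↦ φ ∘ π` between state spaces induced by a unital *-homomorphism `π`. -/
def pullbackState {D A : Type u} [CStarAlgebra D] [CStarAlgebra A] (π : D →⋆ₐ[ℂ] A)
    (φ : stateSpace A) : stateSpace D :=
  ⟨StrongDual.toWeakDual
      ((WeakDual.toStrongDual φ.1).comp ⟨π.toAlgHom.toLinearMap, map_continuous π⟩), by
    refine ⟨?_, fun a => ?_⟩
    · change φ.1 (π 1) = 1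
      rw [map_one]
      exact φ.2.1
    · change 0 ≤ φ.1 (π (star a * a))
      rw [map_mul, map_star]
      exact φ.2.2 _⟩

theorem pullbackState_apply {D A : Type u} [CStarAlgebra D] [CStarAlgebra A] (π : D →⋆ₐ[ℂ] A)
    (φ : stateSpace A) (d : D) : (pullbackState π φ).1 d = φ.1 (π d) := rfl

/-- The extent of a tunnel. -/
def Tunnel.extent {A B : QQCMS.{u} F} (τ : Tunnel A B) : ℝ≥0∞ :=
  max
    (hausdorffDist (mongeKantorovich τ.D.L) Set.univ (Set.range (pullbackState τ.π₁)))
    (hausdorffDist (mongeKantorovich τ.D.L) Set.univ (Set.range (pullbackState τ.π₂)))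

/-- The dual propinquity: the infimum of the extents of all `F`-tunnels from `A` to `B`. -/
def dualPropinquity (A B : QQCMS.{u} F) : ℝ≥0∞ := ⨅ τ : Tunnel A B, τ.extent

/-- A class of `F`-quasi-Leibniz quantum compact metric spaces is closed for the dual propinquity
when it contains the limits of its convergent sequences. -/
def IsPropinquityClosed (𝒞 : Set (QQCMS.{u} F)) : Prop :=
  ∀ (A : ℕ → QQCMS.{u} F) (B : QQCMS.{u} F), (∀ n, A n ∈ 𝒞) →
    Filter.Tendsto (fun n => dualPropinquity (A n) B) Filter.atTop (𝓝 0) → B ∈ 𝒞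

/-! ### Ergodic actions -/

/-- The action of an automorphism on self-adjoint elements. -/
def autSelfAdjoint {A : Type u} [CStarAlgebra A] (θ : A ≃⋆ₐ[ℂ] A) (a : selfAdjoint A) :
    selfAdjoint A :=
  ⟨θ a, by
    rw [selfAdjoint.mem_iff, ← map_star, a.2.star_eq]⟩

/-- An action by *-automorphisms is strongly continuous when all its orbit maps are continuous. -/
def IsStronglyContinuous {H A : Type*} [Group H] [TopologicalSpace H] [CStarAlgebra A]
    (α : H →* (A ≃⋆ₐ[ℂ] A)) : Prop :=
  ∀ a : A, Continuous fun h => α h a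

/-- An action by *-automorphisms is ergodic when its fixed points are the scalar multiples of
the unit. -/
def IsErgodicAction {H A : Type*} [Group H] [CStarAlgebra A] (α : H →* (A ≃⋆ₐ[ℂ] A)) : Prop :=
  {a : A | ∀ h, α h a = a} = Set.range (algebraMap ℂ A)

/-- The class of `F`-quasi-Leibniz quantum compact metric spaces which carry a strongly continuous
ergodic action, by 1-Lipschitz automorphisms, of some member `H` of `𝒢`, with L-seminorm
dominating the seminorm defined by the action and the length function. -/
def ergodicClass {G : Type*} [Group G] [TopologicalSpace G] (ℓ : G → ℝ≥0) (𝒢 : Set (Subgroup G))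
    (F : ℝ≥0∞ → ℝ≥0∞ → ℝ≥0∞ → ℝ≥0∞ → ℝ≥0∞) : Set (QQCMS.{u} F) :=
  {A | ∃ H ∈ 𝒢, ∃ α : H →* (A.carrier ≃⋆ₐ[ℂ] A.carrier),
    IsStronglyContinuous α ∧ IsErgodicAction α ∧
    (∀ a : selfAdjoint A.carrier,
      (⨆ (h : H) (_ : h ≠ 1), ‖(a : A.carrier) - α h a‖ₑ / (ℓ h : ℝ≥0∞)) ≤ A.L a) ∧
    ∀ (h : H) (a : selfAdjoint A.carrier), A.L (autSelfAdjoint (α h) a) ≤ A.L a}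

end Propinquity

end

/-! The action on the limit is built by carrying automorphisms across tunnels of vanishing extent
and taking limits along a free ultrafilter.

Small extent means that every state of the tunnel algebra is close to one factoring through either
quotient. Hence, on elements of bounded Lipschitz seminorm, both quotient maps almost preserve the
norm: up to a small error on self-adjoint elements (`eventually_norm_le`), up to a further factor 2
in general (`eventually_norm_le_of_isLip`). Lift `b` to the tunnel, push it to `A n`, apply the
automorphism, lift back and push to `B`: for self-adjoint `b` of finite seminorm the results lie in
one Lipschitz ball, which is norm compact (`isCompact_lipBall`), so they converge along the
ultrafilter. `LimitRel` records this procedure as a relation. The estimate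
`LimitRel.norm_sub_le_of_isLip` makes it single-valued and bounded, and its stability under the
algebraic operations and under limits makes it the graph of a *-automorphism, `limitAut`.

The groups `H n` converge along the ultrafilter to a member `K` of `𝒢`
(`exists_mem_coe_eq_limitSet`), and each `g` in `K` is a limit of some `x n` in `H n`. Domination of
the action seminorms makes the limit automorphism depend on `g` alone, and conjugation invariance of
`ℓ` makes products converge to products, so an action of `K` arises (`exists_limit_action`). The two
seminorm conditions pass to the limit (`limit_action_lipschitz`). For ergodicity, a fixed point of
the limit is transported to an element of some `A n` that is almost invariant under all of `H n`;
Haar averaging puts it near a scalar, and the tunnel brings this back to `B`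
(`isErgodicAction_of_limit`). -/

noncomputable section

open Filter

namespace Propinquity

/-! ### States, and norm compactness of Lipschitz balls -/

section States

variable {A : Type u} [CStarAlgebra A]

section Order

variable [PartialOrder A] [StarOrderedRing A]

/-- The closed cone of positive elements. -/
def positiveCone (A : Type u) [CStarAlgebra A] [PartialOrder A] [StarOrderedRing A] :
    ProperCone ℝ A where
  carrier := {a | 0 ≤ a}
  add_mem' := fun ha hb => add_nonneg ha hb
  zero_mem' := le_rfl
  smul_mem' := fun c _ ha => smul_nonneg c.2 ha
  isClosed' := CStarAlgebra.isClosed_nonneg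

theorem mem_positiveCone {a : A} : a ∈ positiveCone A ↔ 0 ≤ a := Iff.rfl

/-- Hahn–Banach: separate `c - a` from the closed positive cone by a real functional, extend it
complex-linearly and normalize at the unit. -/
theorem exists_state_lt {a : A} (ha : IsSelfAdjoint a) {c : ℝ} (h : ¬ a ≤ algebraMap ℝ A c) :
    ∃ φ : stateSpace A, c < (φ.1 a).re := by
  have hx : algebraMap ℝ A c - a ∉ positiveCone A := by
    rwa [mem_positiveCone, sub_nonneg]
  obtain ⟨f, hf, hfx⟩ := (positiveCone A).hyperplane_separation_point hx
  simp only [mem_positiveCone] at hf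
  -- The separating functional is uncontrolled on skew-adjoint elements. Composing with the
  -- self-adjoint part kills it there, so that the complex extension is real on self-adjoint
  -- elements and equals `f`.
  set g : StrongDual ℝ A := f.comp
    ((selfAdjoint.submodule ℝ A).subtypeL.comp (selfAdjointPartL ℝ A)) with hg
  have hgsa : ∀ x : A, IsSelfAdjoint x → g x = f x := by
    intro x hx
    change f ((selfAdjointPart ℝ x : selfAdjoint A) : A) = f x
    rw [hx.coe_selfAdjointPart_apply ℝ]
  have hgI : ∀ x : A, IsSelfAdjoint x → g (Complex.I • x) = 0 := by
    intro x hx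
    change f ((selfAdjointPart ℝ (Complex.I • x) : selfAdjoint A) : A) = 0
    simp [selfAdjointPart_apply_coe, hx.star_eq]
  have hfr : ∀ r : ℝ, f (algebraMap ℝ A r) = r * f 1 := by
    intro r
    rw [Algebra.algebraMap_eq_smul_one, map_smul, smul_eq_mul]
  -- If `f 1` vanished, positivity of `f` at `‖x‖ + x`, with `x = c - a`, would contradict `f x <
  -- 0`.
  have h1 : 0 < f 1 := by
    have h0 : 0 ≤ f 1 := hf 1 zero_le_one
    refine h0.lt_of_ne' fun h1 => ?_
    have hb : 0 ≤ f (algebraMap ℝ A ‖algebraMap ℝ A c - a‖ + (algebraMap ℝ A c - a)) := by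
      refine hf _ ?_
      have hsa : IsSelfAdjoint (algebraMap ℝ A c - a) :=
        ((IsSelfAdjoint.all c).algebraMap A).sub ha
      have := hsa.neg_algebraMap_norm_le_self
      exact neg_le_iff_add_nonneg'.mp this
    rw [map_add, hfr, h1] at hb
    linarith
  have hext : ∀ x : A, IsSelfAdjoint x → (g.extendRCLike (𝕜 := ℂ)) x = (f x : ℂ) := by
    intro x hx
    have h2 := g.extendRCLike_apply (𝕜 := ℂ) x
    rw [h2, hgsa x hx]
    have : g ((RCLike.I : ℂ) • x) = 0 := hgI x hx
    rw [this]
    simp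
  refine ⟨⟨StrongDual.toWeakDual (((f 1 : ℂ)⁻¹) • g.extendRCLike (𝕜 := ℂ)), ?_, fun b => ?_⟩, ?_⟩
  · change (f 1 : ℂ)⁻¹ * (g.extendRCLike (𝕜 := ℂ)) 1 = 1
    rw [hext 1 (.one A)]
    exact inv_mul_cancel₀ (by exact_mod_cast h1.ne')
  · change 0 ≤ (f 1 : ℂ)⁻¹ * (g.extendRCLike (𝕜 := ℂ)) (star b * b)
    rw [hext _ (.star_mul_self b)]
    have := mul_nonneg (inv_nonneg.mpr h1.le) (hf _ (star_mul_self_nonneg b))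
    exact_mod_cast this
  · change c < ((f 1 : ℂ)⁻¹ * (g.extendRCLike (𝕜 := ℂ)) a).re
    rw [hext _ ha]
    have h3 : ((f 1 : ℂ)⁻¹ * (f a : ℂ)).re = (f 1)⁻¹ * f a := by
      rw [← Complex.ofReal_inv, ← Complex.ofReal_mul, Complex.ofReal_re]
    rw [h3, inv_mul_eq_div, lt_div_iff₀ h1]
    rw [map_sub, hfr] at hfx
    linarith

theorem state_nonneg (φ : stateSpace A) {a : A} (ha : 0 ≤ a) : 0 ≤ φ.1 a := by
  obtain ⟨b, rfl⟩ := CStarAlgebra.nonneg_iff_eq_star_mul_self.mp ha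
  exact φ.2.2 b

end Order

theorem state_algebraMap (φ : stateSpace A) (r : ℂ) : φ.1 (algebraMap ℂ A r) = r := by
  rw [Algebra.algebraMap_eq_smul_one, map_smul, φ.2.1, smul_eq_mul, mul_one]

theorem norm_state_le (φ : stateSpace A) (a : selfAdjoint A) : ‖φ.1 (a : A)‖ ≤ ‖(a : A)‖ := by
  let _ := CStarAlgebra.spectralOrder A
  let _ := CStarAlgebra.spectralOrderedRing A
  have hr : ∀ r : ℝ, φ.1 (algebraMap ℝ A r) = (r : ℂ) := fun r => by
    rw [IsScalarTower.algebraMap_apply ℝ ℂ A]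
    exact state_algebraMap φ _
  have h1 : 0 ≤ φ.1 (algebraMap ℝ A ‖(a : A)‖ - a) :=
    state_nonneg φ (sub_nonneg.mpr a.2.le_algebraMap_norm_self)
  have h2 : 0 ≤ φ.1 (algebraMap ℝ A ‖(a : A)‖ + a) :=
    state_nonneg φ (neg_le_iff_add_nonneg'.mp a.2.neg_algebraMap_norm_le_self)
  rw [map_sub, hr] at h1
  rw [map_add, hr] at h2
  have him : (φ.1 (a : A)).im = 0 := by
    have := (Complex.nonneg_iff.mp h2).2
    simpa using this.symm
  have h3 := (Complex.nonneg_iff.mp h1).1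
  have h4 := (Complex.nonneg_iff.mp h2).1
  have h5 : φ.1 (a : A) = ((φ.1 (a : A)).re : ℂ) := Complex.ext rfl (by simp [him])
  rw [h5, Complex.norm_real, Real.norm_eq_abs, abs_le]
  simp at h3 h4
  constructor <;> linarith

/-- The norm of a self-adjoint element is controlled by its values on states. -/
theorem norm_le_of_forall_state [Nontrivial A] (a : selfAdjoint A) {c : ℝ}
    (h : ∀ φ : stateSpace A, ‖φ.1 (a : A)‖ ≤ c) : ‖(a : A)‖ ≤ c := by
  let _ := CStarAlgebra.spectralOrder A
  let _ := CStarAlgebra.spectralOrderedRing A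
  -- The norm of `a` lies in the spectrum of `a` or of `-a`; the claim is proved for either sign at
  -- once.
  have key : ∀ b : selfAdjoint A, (∀ φ : stateSpace A, ‖φ.1 (b : A)‖ ≤ c) →
      ‖(a : A)‖ ∈ spectrum ℝ (b : A) → ‖(a : A)‖ ≤ c := by
    intro b hb hs
    by_contra hc
    have : ¬ (b : A) ≤ algebraMap ℝ A c := fun hle =>
      hc ((le_algebraMap_iff_spectrum_le b.2).mp hle _ hs)
    obtain ⟨φ, hφ⟩ := exists_state_lt b.2 this
    exact absurd (hb φ) (not_le.mpr (hφ.trans_le (Complex.re_le_norm _)))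
  rcases CStarAlgebra.norm_or_neg_norm_mem_spectrum a.2 with hs | hs
  · exact key a h hs
  · refine key (-a) (fun φ => ?_) ?_
    · have : φ.1 ((-a : selfAdjoint A) : A) = - φ.1 (a : A) := by simp
      rw [this, norm_neg]; exact h φ
    · rw [AddSubgroup.coe_neg, ← spectrum.neg_eq, Set.mem_neg]
      exact hs

/-- Banach–Alaoglu. The radius 2 suffices and comes from bounding a state separately on real and
imaginary parts. -/
theorem isCompact_stateSpace (A : Type u) [CStarAlgebra A] : IsCompact (stateSpace A) := by
  have hcl : IsClosed (stateSpace A) := by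
    have : stateSpace A = {φ : WeakDual ℂ A | φ 1 = 1} ∩
        ⋂ a : A, {φ : WeakDual ℂ A | φ (star a * a) ∈ {z : ℂ | 0 ≤ z}} := by
      ext φ; simp [stateSpace]
    rw [this]
    refine (isClosed_eq (WeakDual.eval_continuous _) continuous_const).inter
      (isClosed_iInter fun a => IsClosed.preimage (WeakDual.eval_continuous _) ?_)
    have : {z : ℂ | 0 ≤ z} = {z : ℂ | 0 ≤ z.re} ∩ {z | 0 = z.im} := by
      ext z; exact Complex.nonneg_iff
    rw [this]
    exact (isClosed_le continuous_const Complex.continuous_re).inter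
      (isClosed_eq continuous_const Complex.continuous_im)
  refine IsCompact.of_isClosed_subset (WeakDual.isCompact_closedBall (0 : StrongDual ℂ A) 2)
    hcl fun φ hφ => ?_
  simp only [Set.mem_preimage, mem_closedBall_zero_iff]
  refine ContinuousLinearMap.opNorm_le_bound _ zero_le_two fun a => ?_
  change ‖φ a‖ ≤ 2 * ‖a‖
  have h1 := norm_state_le ⟨φ, hφ⟩ (realPart a)
  have h2 := norm_state_le ⟨φ, hφ⟩ (imaginaryPart a)
  have h3 : ‖(realPart a : A)‖ ≤ ‖a‖ := realPart.norm_le a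
  have h4 : ‖(imaginaryPart a : A)‖ ≤ ‖a‖ := imaginaryPart.norm_le a
  have h5 : φ a = φ (realPart a : A) + Complex.I • φ (imaginaryPart a : A) := by
    rw [← map_smul, ← map_add, realPart_add_I_smul_imaginaryPart]
  rw [h5]
  refine (norm_add_le _ _).trans ?_
  rw [norm_smul, Complex.norm_I, one_mul]
  simp only at h1 h2
  linarith

variable {F : ℝ≥0∞ → ℝ≥0∞ → ℝ≥0∞ → ℝ≥0∞ → ℝ≥0∞} {L : selfAdjoint A → ℝ≥0∞}

theorem norm_state_sub_le (hL : IsLSeminorm F L) {a : selfAdjoint A} {l : ℝ≥0} (ha : L a ≤ l)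
    (φ ψ : stateSpace A) :
    ‖φ.1 (a : A) - ψ.1 (a : A)‖ₑ ≤ l * mongeKantorovich L φ ψ := by
  have key : ∀ r : ℝ≥0, 0 < r → L a ≤ r →
      ‖φ.1 (a : A) - ψ.1 (a : A)‖ₑ ≤ r * mongeKantorovich L φ ψ := by
    intro r hr har
    have hLr : L ((r : ℝ)⁻¹ • a) ≤ 1 := by
      rw [hL.smul_eq]
      have : ‖((r : ℝ)⁻¹)‖ₑ = (r : ℝ≥0∞)⁻¹ := by
        rw [enorm_inv (by exact_mod_cast hr.ne')]; simp
      rw [this]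
      calc (r : ℝ≥0∞)⁻¹ * L a ≤ (r : ℝ≥0∞)⁻¹ * r := by gcongr
        _ = 1 := ENNReal.inv_mul_cancel (by exact_mod_cast hr.ne') ENNReal.coe_ne_top
    have h1 : ‖φ.1 (((r : ℝ)⁻¹ • a : selfAdjoint A) : A) - ψ.1 (((r : ℝ)⁻¹ • a : selfAdjoint A) : A)‖ₑ
        ≤ mongeKantorovich L φ ψ :=
      le_iSup₂ (f := fun (a : selfAdjoint A) (_ : L a ≤ 1) => ‖φ.1 (a : A) - ψ.1 (a : A)‖ₑ) _ hLr
    have h2 : φ.1 (a : A) - ψ.1 (a : A) = (r : ℂ) * (φ.1 (((r : ℝ)⁻¹ • a : selfAdjoint A) : A) -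
        ψ.1 (((r : ℝ)⁻¹ • a : selfAdjoint A) : A)) := by
      have h3 : (((r : ℝ)⁻¹ • a : selfAdjoint A) : A) = ((r : ℂ)⁻¹) • (a : A) := by
        rw [selfAdjoint.val_smul, ← Complex.coe_smul]; simp
      rw [h3, map_smul, map_smul, smul_eq_mul, smul_eq_mul, ← mul_sub, ← mul_assoc,
        mul_inv_cancel₀ (by exact_mod_cast hr.ne'), one_mul]
    rw [h2, enorm_mul]
    have : ‖(r : ℂ)‖ₑ = r := by
      rw [← ofReal_norm, Complex.norm_real]; simp
    rw [this]
    gcongr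
  -- Rescaling by `l⁻¹` is impossible here, but seminorm zero forces a scalar, on which all states
  -- agree.
  by_cases h0 : l = 0
  · have hL0 : L a = 0 := by simpa [h0] using ha
    obtain ⟨t, rfl⟩ := (hL.eq_zero_iff a).mp hL0
    have : ∀ φ : stateSpace A, φ.1 ((t • (1 : selfAdjoint A) : selfAdjoint A) : A) = t := by
      intro φ
      rw [selfAdjoint.val_smul, selfAdjoint.val_one, ← Complex.coe_smul, map_smul, φ.2.1]
      simp
    rw [this, this, sub_self, enorm_zero]
    exact zero_le
  · exact key l (pos_iff_ne_zero.mpr h0) ha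

/-- Rieffel's compactness of Lipschitz balls. -/
theorem isCompact_lipBall [Nontrivial A] (hL : IsLSeminorm F L) (l : ℝ≥0) (M : ℝ) :
    IsCompact {a : selfAdjoint A | L a ≤ l ∧ ‖(a : A)‖ ≤ M} := by
  obtain ⟨m, hmt, hmd⟩ := hL.metrizes
  have hcl : IsClosed {a : selfAdjoint A | L a ≤ l ∧ ‖(a : A)‖ ≤ M} := by
    refine IsClosed.inter (hL.lsc.isClosed_preimage (l : ℝ≥0∞)) ?_
    exact isClosed_le (continuous_norm.comp continuous_subtype_val) continuous_const
  have hcpt : CompactSpace (stateSpace A) := isCompact_iff_compactSpace.mp (isCompact_stateSpace A)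
  refine isCompact_iff_ultrafilter_le_nhds.mpr fun U hU => ?_
  have hUs : {a : selfAdjoint A | L a ≤ l ∧ ‖(a : A)‖ ≤ M} ∈ U := le_principal_iff.mp hU
  -- Elements of the ball are equi-Lipschitz on the totally bounded state space. Their values on a
  -- finite net converge along `U`, and the net controls all states, hence the norm. The comparison
  -- has four errors `δ = ε / 8`.
  have hcauchy : Cauchy (U : Filter (selfAdjoint A)) := by
    refine Metric.cauchy_iff.mpr ⟨U.neBot, fun ε hε => ?_⟩
    set δ : ℝ := ε / 8 with hδ
    have hδ0 : 0 < δ := by positivity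
    obtain ⟨η, hη0, hη⟩ : ∃ η : ℝ, 0 < η ∧ l * η ≤ δ := by
      refine ⟨δ / (l + 1), by positivity, ?_⟩
      rw [mul_div_assoc', div_le_iff₀ (by positivity)]
      nlinarith [l.2]
    obtain ⟨T, hT⟩ : ∃ T : Finset (stateSpace A), ∀ φ, ∃ ψ ∈ T,
        mongeKantorovich L φ ψ ≤ ENNReal.ofReal η := by
      have hc2 : @CompactSpace (stateSpace A) m.toUniformSpace.toTopologicalSpace := by
        rw [hmt]; exact hcpt
      obtain ⟨T, -, hTf, hT⟩ := @IsCompact.finite_cover_balls _ m.toPseudoMetricSpace _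
        hc2.isCompact_univ η hη0
      refine ⟨hTf.toFinset, fun φ => ?_⟩
      obtain ⟨ψ, hψ, hφψ⟩ := Set.mem_iUnion₂.mp (hT (Set.mem_univ φ))
      refine ⟨ψ, hTf.mem_toFinset.mpr hψ, ?_⟩
      rw [← hmd, m.edist_dist]
      exact ENNReal.ofReal_le_ofReal (le_of_lt hφψ)
    have hlim : ∀ ψ : stateSpace A, ∃ z : ℂ, ∀ᶠ a : selfAdjoint A in (U : Filter (selfAdjoint A)),
        ‖ψ.1 (a : A) - z‖ < δ := by
      intro ψ
      have : (U.map fun a : selfAdjoint A => ψ.1 (a : A) : Filter ℂ) ≤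
          𝓟 (Metric.closedBall 0 M) := by
        rw [le_principal_iff]
        refine mem_map.mpr (mem_of_superset hUs fun a ha => ?_)
        simpa using (norm_state_le ψ a).trans ha.2
      obtain ⟨z, -, hz⟩ := isCompact_iff_ultrafilter_le_nhds.mp
        (isCompact_closedBall (0 : ℂ) M) _ this
      refine ⟨z, ?_⟩
      have := hz (Metric.ball_mem_nhds z hδ0)
      refine mem_of_superset this fun a ha => ?_
      simpa [dist_eq_norm] using ha
    choose z hz using hlim
    refine ⟨_, inter_mem hUs ((Finset.eventually_all T).mpr fun ψ _ => hz ψ), ?_⟩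
    rintro a ⟨ha, haT⟩ b ⟨hb, hbT⟩
    have h4 : ‖((a - b : selfAdjoint A) : A)‖ ≤ 4 * δ := by
      refine norm_le_of_forall_state (a - b) fun φ => ?_
      obtain ⟨ψ, hψ, hd⟩ := hT φ
      have key : ∀ c : selfAdjoint A, L c ≤ l → ‖φ.1 (c : A) - ψ.1 (c : A)‖ ≤ δ := by
        intro c hc
        have h := (norm_state_sub_le hL hc φ ψ).trans (mul_le_mul_right hd _)
        rw [← ofReal_norm, ← ENNReal.ofReal_coe_nnreal (p := l),
          ← ENNReal.ofReal_mul l.coe_nonneg,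
          ENNReal.ofReal_le_ofReal_iff (by positivity)] at h
        exact h.trans hη
      have h1 := key a ha.1
      have h2 := key b hb.1
      have h3 := haT ψ hψ
      have h4 := hbT ψ hψ
      have h5 : φ.1 ((a - b : selfAdjoint A) : A) = (φ.1 (a : A) - ψ.1 (a : A)) +
          (ψ.1 (a : A) - z ψ) - (ψ.1 (b : A) - z ψ) - (φ.1 (b : A) - ψ.1 (b : A)) := by
        rw [AddSubgroupClass.coe_sub, map_sub]; ring
      rw [h5]
      refine (norm_sub_le _ _).trans ?_
      have := norm_sub_le ((φ.1 (a : A) - ψ.1 (a : A)) + (ψ.1 (a : A) - z ψ)) (ψ.1 (b : A) - z ψ)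
      have := norm_add_le (φ.1 (a : A) - ψ.1 (a : A)) (ψ.1 (a : A) - z ψ)
      linarith
    rw [dist_eq_norm]
    change ‖((a - b : selfAdjoint A) : A)‖ < ε
    linarith
  have : CompleteSpace (selfAdjoint A) := (isClosed_eq continuous_star continuous_id).completeSpace_coe
  have hcomplete : IsComplete {a : selfAdjoint A | L a ≤ l ∧ ‖(a : A)‖ ≤ M} := hcl.isComplete
  exact hcomplete U hcauchy hU

end States

variable {F : ℝ≥0∞ → ℝ≥0∞ → ℝ≥0∞ → ℝ≥0∞ → ℝ≥0∞}

/-! ### Real and imaginary parts of products and images -/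

theorem realPart_star' {A : Type*} [CStarAlgebra A] (a : A) :
    realPart (star a) = realPart a := by
  ext; simp [realPart_apply_coe, add_comm]

theorem mul_eq_realPart_imaginaryPart {A : Type*} [CStarAlgebra A] (a b : A) :
    a * b = (realPart a : A) * realPart b - (imaginaryPart a : A) * imaginaryPart b +
      Complex.I • ((realPart a : A) * imaginaryPart b) +
      Complex.I • ((imaginaryPart a : A) * realPart b) := by
  conv_lhs => rw [← realPart_add_I_smul_imaginaryPart a, ← realPart_add_I_smul_imaginaryPart b]
  simp only [add_mul, mul_add, smul_mul_assoc, mul_smul_comm, smul_add, smul_smul,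
    Complex.I_mul_I, neg_smul, one_smul]
  abel

theorem imaginaryPart_star' {A : Type*} [CStarAlgebra A] (a : A) :
    imaginaryPart (star a) = -imaginaryPart a := by
  ext; simp [imaginaryPart_apply_coe, ← smul_neg]

theorem imaginaryPart_one' (A : Type*) [CStarAlgebra A] : imaginaryPart (1 : A) = 0 := by
  ext; simp [imaginaryPart_apply_coe]

theorem map_realPart {A B : Type*} [CStarAlgebra A] [CStarAlgebra B] (π : A →⋆ₐ[ℂ] B) (a : A) :
    π (realPart a : A) = (realPart (π a) : B) := by
  rw [realPart_apply_coe, realPart_apply_coe, ← Complex.coe_smul, ← Complex.coe_smul, map_smul,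
    map_add, map_star]

theorem map_imaginaryPart {A B : Type*} [CStarAlgebra A] [CStarAlgebra B] (π : A →⋆ₐ[ℂ] B)
    (a : A) : π (imaginaryPart a : A) = (imaginaryPart (π a) : B) := by
  rw [imaginaryPart_apply_coe, imaginaryPart_apply_coe, ← Complex.coe_smul, ← Complex.coe_smul,
    map_smul, map_smul, map_sub, map_star]

/-- Reduces arbitrary products to Jordan and Lie products of self-adjoint elements, the only ones
the quasi-Leibniz inequality controls. -/
theorem realPart_mul_eq {A : Type*} [CStarAlgebra A] (a b : A) :
    realPart (a * b) = jordanMul (realPart a) (realPart b) -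
      jordanMul (imaginaryPart a) (imaginaryPart b) -
      lieMul (realPart a) (imaginaryPart b) - lieMul (imaginaryPart a) (realPart b) := by
  conv_lhs => rw [mul_eq_realPart_imaginaryPart a b]
  simp only [map_add, map_sub, realPart_I_smul, jordanMul, lieMul]
  abel

theorem imaginaryPart_mul_eq {A : Type*} [CStarAlgebra A] (a b : A) :
    imaginaryPart (a * b) = lieMul (realPart a) (realPart b) -
      lieMul (imaginaryPart a) (imaginaryPart b) +
      jordanMul (realPart a) (imaginaryPart b) + jordanMul (imaginaryPart a) (realPart b) := by
  conv_lhs => rw [mul_eq_realPart_imaginaryPart a b]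
  simp only [map_add, map_sub, imaginaryPart_I_smul, jordanMul, lieMul]

namespace IsLSeminorm

variable {A : Type*} [CStarAlgebra A] {L : selfAdjoint A → ℝ≥0∞}

theorem neg_eq (hL : IsLSeminorm F L) (a : selfAdjoint A) : L (-a) = L a := by
  have := hL.smul_eq (-1) a
  simpa using this

theorem sub_le (hL : IsLSeminorm F L) (a b : selfAdjoint A) : L (a - b) ≤ L a + L b := by
  rw [sub_eq_add_neg, ← hL.neg_eq b]; exact hL.add_le _ _

end IsLSeminorm

/-! ### Elements whose real and imaginary parts have finite Lipschitz seminorm -/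

/-- The real and imaginary parts of `a` have Lipschitz seminorm at most `l`. -/
def IsLip (A : QQCMS.{u} F) (l : ℝ≥0) (a : A.carrier) : Prop :=
  A.L (realPart a) ≤ l ∧ A.L (imaginaryPart a) ≤ l

namespace IsLip

variable {A : QQCMS.{u} F} {l m : ℝ≥0} {a b : A.carrier}

theorem mono (h : IsLip A l a) (hlm : l ≤ m) : IsLip A m a :=
  ⟨h.1.trans (by exact_mod_cast hlm), h.2.trans (by exact_mod_cast hlm)⟩

theorem add (ha : IsLip A l a) (hb : IsLip A m b) : IsLip A (l + m) (a + b) := by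
  rw [IsLip, map_add, map_add, ENNReal.coe_add]
  exact ⟨(A.isLSeminorm.add_le _ _).trans (add_le_add ha.1 hb.1),
    (A.isLSeminorm.add_le _ _).trans (add_le_add ha.2 hb.2)⟩

theorem sub (ha : IsLip A l a) (hb : IsLip A m b) : IsLip A (l + m) (a - b) := by
  rw [IsLip, map_sub, map_sub, ENNReal.coe_add]
  exact ⟨(A.isLSeminorm.sub_le _ _).trans (add_le_add ha.1 hb.1),
    (A.isLSeminorm.sub_le _ _).trans (add_le_add ha.2 hb.2)⟩

theorem star_mem (ha : IsLip A l a) : IsLip A l (star a) := by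
  rw [IsLip, realPart_star', imaginaryPart_star', A.isLSeminorm.neg_eq]
  exact ha

theorem of_selfAdjoint {x : selfAdjoint A.carrier} (hx : A.L x ≤ l) :
    IsLip A l (x : A.carrier) := by
  have h0 : A.L 0 = 0 := (A.isLSeminorm.eq_zero_iff 0).mpr ⟨0, by simp⟩
  rw [IsLip, selfAdjoint.realPart_coe, selfAdjoint.imaginaryPart_coe, h0]
  exact ⟨hx, zero_le⟩

theorem I_smul (ha : IsLip A l a) : IsLip A l (Complex.I • a) := by
  rw [IsLip, realPart_I_smul, imaginaryPart_I_smul, A.isLSeminorm.neg_eq]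
  exact ⟨ha.2, ha.1⟩

theorem algebraMap (z : ℂ) : IsLip A 0 (algebraMap ℂ A.carrier z) := by
  have key : ∀ r : ℝ, A.L (r • 1) = 0 := fun r => (A.isLSeminorm.eq_zero_iff _).mpr ⟨r, rfl⟩
  rw [IsLip, Algebra.algebraMap_eq_smul_one, realPart_smul, imaginaryPart_smul]
  simp only [realPart_one, imaginaryPart_one', smul_zero, sub_zero, zero_add]
  rw [key, key]
  simp

theorem mul (hF : IsAdmissible F) (hF_finite : ∀ x y s t : ℝ≥0, F x y s t ≠ ⊤) {M : ℝ≥0}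
    (ha : IsLip A l a) (hb : IsLip A l b) (haM : ‖a‖ ≤ M) (hbM : ‖b‖ ≤ M) :
    IsLip A (4 * (F M M l l).toNNReal) (a * b) := by
  -- Finiteness of `F` keeps `toNNReal` from collapsing to 0. The factor 4 counts the Jordan and Lie
  -- terms in each part of the product.
  have hc : ((4 * (F M M l l).toNNReal : ℝ≥0) : ℝ≥0∞) =
      F M M l l + F M M l l + F M M l l + F M M l l := by
    rw [ENNReal.coe_mul, ENNReal.coe_toNNReal (hF_finite M M l l)]
    push_cast; ring
  have hn : ∀ {x : A.carrier}, ‖x‖ ≤ M → ‖x‖ₑ ≤ M := fun {x} hx => by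
    rw [← ofReal_norm, ← ENNReal.ofReal_coe_nnreal]; exact ENNReal.ofReal_le_ofReal hx
  have key : ∀ {x y : selfAdjoint A.carrier}, A.L x ≤ l → A.L y ≤ l → ‖(x : A.carrier)‖ ≤ M →
      ‖(y : A.carrier)‖ ≤ M →
      A.L (jordanMul x y) ≤ F M M l l ∧ A.L (lieMul x y) ≤ F M M l l := by
    intro x y hx hy hxM hyM
    have h := A.isLSeminorm.quasi_leibniz x y (hx.trans_lt ENNReal.coe_lt_top).ne
      (hy.trans_lt ENNReal.coe_lt_top).ne
    have h2 := h.trans (hF.mono (hn hxM) (hn hyM) hx hy)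
    exact ⟨(le_max_left _ _).trans h2, (le_max_right _ _).trans h2⟩
  have ha1 := (realPart.norm_le a).trans haM
  have ha2 := (imaginaryPart.norm_le a).trans haM
  have hb1 := (realPart.norm_le b).trans hbM
  have hb2 := (imaginaryPart.norm_le b).trans hbM
  have h11 := key ha.1 hb.1 ha1 hb1
  have h12 := key ha.1 hb.2 ha1 hb2
  have h21 := key ha.2 hb.1 ha2 hb1
  have h22 := key ha.2 hb.2 ha2 hb2
  rw [IsLip, hc, realPart_mul_eq, imaginaryPart_mul_eq]
  have hL := A.isLSeminorm
  constructor
  · refine (hL.sub_le _ _).trans (add_le_add ((hL.sub_le _ _).trans (add_le_add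
      ((hL.sub_le _ _).trans (add_le_add h11.1 h22.1)) h12.2)) h21.2)
  · refine (hL.add_le _ _).trans (add_le_add ((hL.add_le _ _).trans (add_le_add
      ((hL.sub_le _ _).trans (add_le_add h11.2 h22.2)) h12.1)) h21.1)

end IsLip

theorem exists_lip_norm_sub_lt (A : QQCMS.{u} F) (b : selfAdjoint A.carrier) {ε : ℝ}
    (hε : 0 < ε) : ∃ x : selfAdjoint A.carrier, A.L x ≠ ∞ ∧ ‖(b : A.carrier) - x‖ < ε := by
  obtain ⟨x, hx, hd⟩ := A.isLSeminorm.dense_dom.exists_dist_lt b hε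
  exact ⟨x, hx, by simpa [dist_eq_norm, Subtype.dist_eq] using hd⟩

/-! ### Quantum isometries -/

namespace IsQuantumIsometry

variable {D A : QQCMS.{u} F} {π : D.carrier →⋆ₐ[ℂ] A.carrier}

theorem L_le (h : IsQuantumIsometry D A π) {d : selfAdjoint D.carrier} {a : selfAdjoint A.carrier}
    (hda : π (d : D.carrier) = a) : A.L a ≤ D.L d := by
  rw [h.quotient]; exact iInf₂_le d hda

theorem exists_lift (h : IsQuantumIsometry D A π) {a : selfAdjoint A.carrier} {l : ℝ≥0∞}
    (ha : A.L a < l) : ∃ d : selfAdjoint D.carrier, π (d : D.carrier) = a ∧ D.L d < l := by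
  rw [h.quotient] at ha
  simpa [iInf_lt_iff] using ha

theorem isLip (h : IsQuantumIsometry D A π) {d : D.carrier} {l : ℝ≥0} (hd : IsLip D l d) :
    IsLip A l (π d) :=
  ⟨(h.L_le (map_realPart π d)).trans hd.1, (h.L_le (map_imaginaryPart π d)).trans hd.2⟩

theorem exists_isLip_lift (h : IsQuantumIsometry D A π) {a : A.carrier} {l m : ℝ≥0}
    (ha : IsLip A l a) (hlm : l < m) : ∃ d : D.carrier, π d = a ∧ IsLip D (m + m) d := by
  have hlm' : (l : ℝ≥0∞) < m := by exact_mod_cast hlm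
  obtain ⟨x, hx, hxl⟩ := h.exists_lift (ha.1.trans_lt hlm')
  obtain ⟨y, hy, hyl⟩ := h.exists_lift (ha.2.trans_lt hlm')
  refine ⟨x + Complex.I • (y : D.carrier), ?_, ?_⟩
  · rw [map_add, map_smul, hx, hy, realPart_add_I_smul_imaginaryPart]
  · exact (IsLip.of_selfAdjoint hxl.le).add (IsLip.of_selfAdjoint hyl.le).I_smul

/-- Each state of `D` is within `χ` of one factoring through `π`, and moving to the latter changes
its value at `d` by at most `l * χ`. -/
theorem norm_le {χ : ℝ} (h : hausdorffDist (mongeKantorovich D.L) Set.univ (Set.range (pullbackState π)) <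
    ENNReal.ofReal χ) (hχ : 0 ≤ χ) {d : selfAdjoint D.carrier} {l : ℝ≥0} (hd : D.L d ≤ l) :
    ‖(d : D.carrier)‖ ≤ ‖π (d : D.carrier)‖ + l * χ := by
  refine norm_le_of_forall_state d fun φ => ?_
  have h1 : (⨅ y ∈ Set.range (pullbackState π), mongeKantorovich D.L φ y) < ENNReal.ofReal χ :=
    lt_of_le_of_lt ((le_iSup₂ (f := fun x (_ : x ∈ Set.univ) =>
      ⨅ y ∈ Set.range (pullbackState π), mongeKantorovich D.L x y) φ
      (Set.mem_univ φ)).trans (le_max_left _ _)) h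
  simp only [Set.mem_range, iInf_lt_iff] at h1
  obtain ⟨_, ⟨ψ, rfl⟩, hψ⟩ := h1
  have h2 := (norm_state_sub_le D.isLSeminorm hd φ (pullbackState π ψ)).trans
    (mul_le_mul_right hψ.le _)
  rw [← ofReal_norm, ← ENNReal.ofReal_coe_nnreal (p := l), ← ENNReal.ofReal_mul l.coe_nonneg,
    ENNReal.ofReal_le_ofReal_iff (by positivity), pullbackState_apply] at h2
  have hsa : IsSelfAdjoint (π (d : D.carrier)) := d.2.map π
  have h3 : ‖ψ.1 (π (d : D.carrier))‖ ≤ ‖π (d : D.carrier)‖ := norm_state_le ψ ⟨_, hsa⟩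
  have := norm_le_norm_add_norm_sub' (φ.1 (d : D.carrier)) (ψ.1 (π (d : D.carrier)))
  linarith

theorem norm_le_of_isLip {χ : ℝ} (h : hausdorffDist (mongeKantorovich D.L) Set.univ
    (Set.range (pullbackState π)) < ENNReal.ofReal χ) (hχ : 0 ≤ χ) {d : D.carrier} {l : ℝ≥0}
    (hd : IsLip D l d) : ‖d‖ ≤ 2 * ‖π d‖ + 2 * l * χ := by
  have h1 := norm_le h hχ hd.1
  have h2 := norm_le h hχ hd.2
  rw [map_realPart] at h1
  rw [map_imaginaryPart] at h2
  have h3 : ‖(realPart (π d) : A.carrier)‖ ≤ ‖π d‖ := realPart.norm_le (π d)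
  have h4 : ‖(imaginaryPart (π d) : A.carrier)‖ ≤ ‖π d‖ := imaginaryPart.norm_le (π d)
  have h5 : ‖d‖ ≤ ‖(realPart d : D.carrier)‖ + ‖(imaginaryPart d : D.carrier)‖ := by
    conv_lhs => rw [← realPart_add_I_smul_imaginaryPart d]
    refine (norm_add_le _ _).trans ?_
    rw [norm_smul, Complex.norm_I, one_mul]
  linarith

end IsQuantumIsometry

/-! ### Sequences of tunnels with vanishing extent -/

section Limit

variable {A : ℕ → QQCMS.{u} F} {B : QQCMS.{u} F} {τ : ∀ n, Tunnel (A n) B} {U : Filter ℕ}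

theorem eventually_extent_lt (hτ : Tendsto (fun n => (τ n).extent) U (𝓝 0)) {χ : ℝ} (hχ : 0 < χ) :
    ∀ᶠ n in U,
      hausdorffDist (mongeKantorovich (τ n).D.L) Set.univ (Set.range (pullbackState (τ n).π₁)) <
        ENNReal.ofReal χ ∧
      hausdorffDist (mongeKantorovich (τ n).D.L) Set.univ (Set.range (pullbackState (τ n).π₂)) <
        ENNReal.ofReal χ := by
  filter_upwards [hτ.eventually_lt_const (ENNReal.ofReal_pos.mpr hχ)] with n hn
  exact max_lt_iff.mp hn

theorem eventually_norm_le (hτ : Tendsto (fun n => (τ n).extent) U (𝓝 0)) (l : ℝ≥0) {ε : ℝ}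
    (hε : 0 < ε) : ∀ᶠ n in U, ∀ d : selfAdjoint (τ n).D.carrier, (τ n).D.L d ≤ l →
      ‖(d : (τ n).D.carrier)‖ ≤ ‖(τ n).π₁ d‖ + ε ∧
      ‖(d : (τ n).D.carrier)‖ ≤ ‖(τ n).π₂ d‖ + ε := by
  obtain ⟨χ, hχ, hl⟩ : ∃ χ : ℝ, 0 < χ ∧ l * χ ≤ ε := by
    refine ⟨ε / (l + 1), by positivity, ?_⟩
    rw [mul_div_assoc', div_le_iff₀ (by positivity)]
    nlinarith [l.2]
  filter_upwards [eventually_extent_lt hτ hχ] with n hn d hd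
  have h1 := IsQuantumIsometry.norm_le hn.1 hχ.le hd
  have h2 := IsQuantumIsometry.norm_le hn.2 hχ.le hd
  constructor <;> linarith

theorem eventually_norm_le_of_isLip (hτ : Tendsto (fun n => (τ n).extent) U (𝓝 0)) (l : ℝ≥0)
    {ε : ℝ} (hε : 0 < ε) : ∀ᶠ n in U, ∀ d : (τ n).D.carrier, IsLip (τ n).D l d →
      ‖d‖ ≤ 2 * ‖(τ n).π₁ d‖ + ε ∧ ‖d‖ ≤ 2 * ‖(τ n).π₂ d‖ + ε := by
  obtain ⟨χ, hχ, hl⟩ : ∃ χ : ℝ, 0 < χ ∧ 2 * l * χ ≤ ε := by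
    refine ⟨ε / (2 * l + 1), by positivity, ?_⟩
    rw [mul_div_assoc', div_le_iff₀ (by positivity)]
    nlinarith [l.2]
  filter_upwards [eventually_extent_lt hτ hχ] with n hn d hd
  have h1 := IsQuantumIsometry.norm_le_of_isLip hn.1 hχ.le hd
  have h2 := IsQuantumIsometry.norm_le_of_isLip hn.2 hχ.le hd
  constructor <;> linarith

end Limit

/-! ### Limits of automorphisms along tunnels -/

section LimitRel

variable {A : ℕ → QQCMS.{u} F} {B : QQCMS.{u} F} {τ : ∀ n, Tunnel (A n) B} {U : Ultrafilter ℕ}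
  {θ θ' : ∀ n, (A n).carrier ≃⋆ₐ[ℂ] (A n).carrier} {b c b' c' : B.carrier}

/-- `c` is a limit of the images of `b` under the automorphisms `θ n`, transported along the
tunnels `τ n` by elements of bounded Lipschitz seminorm. -/
def LimitRel (τ : ∀ n, Tunnel (A n) B) (U : Ultrafilter ℕ)
    (θ : ∀ n, (A n).carrier ≃⋆ₐ[ℂ] (A n).carrier) (b c : B.carrier) : Prop :=
  ∀ ε : ℝ, 0 < ε → ∃ l : ℝ≥0, ∀ᶠ n in (U : Filter ℕ), ∃ d e : (τ n).D.carrier,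
    IsLip (τ n).D l d ∧ IsLip (τ n).D l e ∧ ‖(τ n).π₂ d - b‖ < ε ∧ ‖(τ n).π₂ e - c‖ < ε ∧
    ‖θ n ((τ n).π₁ d) - (τ n).π₁ e‖ < ε

namespace LimitRel

theorem of_algebraMap (z : ℂ) :
    LimitRel τ U θ (algebraMap ℂ B.carrier z) (algebraMap ℂ B.carrier z) := by
  intro ε hε
  refine ⟨0, Eventually.of_forall fun n => ⟨algebraMap ℂ _ z, algebraMap ℂ _ z,
    IsLip.algebraMap z, IsLip.algebraMap z, ?_, ?_, ?_⟩⟩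
  all_goals
    simp only [AlgHomClass.commutes, sub_self, norm_zero]
    exact hε

theorem add (h : LimitRel τ U θ b c) (h' : LimitRel τ U θ b' c') :
    LimitRel τ U θ (b + b') (c + c') := by
  intro ε hε
  obtain ⟨l, hl⟩ := h (ε / 2) (half_pos hε)
  obtain ⟨l', hl'⟩ := h' (ε / 2) (half_pos hε)
  refine ⟨l + l', ?_⟩
  filter_upwards [hl, hl'] with n ⟨d, e, hd, he, h1, h2, h3⟩ ⟨d', e', hd', he', h1', h2', h3'⟩
  refine ⟨d + d', e + e', hd.add hd', he.add he', ?_, ?_, ?_⟩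
  · rw [map_add, add_sub_add_comm]
    linarith [norm_add_le ((τ n).π₂ d - b) ((τ n).π₂ d' - b')]
  · rw [map_add, add_sub_add_comm]
    linarith [norm_add_le ((τ n).π₂ e - c) ((τ n).π₂ e' - c')]
  · rw [map_add, map_add, map_add, add_sub_add_comm]
    linarith [norm_add_le (θ n ((τ n).π₁ d) - (τ n).π₁ e) (θ n ((τ n).π₁ d') - (τ n).π₁ e')]

theorem star_star (h : LimitRel τ U θ b c) : LimitRel τ U θ (star b) (star c) := by
  intro ε hε
  obtain ⟨l, hl⟩ := h ε hε
  refine ⟨l, ?_⟩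
  filter_upwards [hl] with n ⟨d, e, hd, he, h1, h2, h3⟩
  refine ⟨star d, star e, hd.star_mem, he.star_mem, ?_, ?_, ?_⟩
  · rwa [map_star, ← star_sub, norm_star]
  · rwa [map_star, ← star_sub, norm_star]
  · rwa [map_star, map_star, map_star, ← star_sub, norm_star]

theorem symm (h : LimitRel τ U θ b c) : LimitRel τ U (fun n => (θ n)⁻¹) c b := by
  intro ε hε
  obtain ⟨l, hl⟩ := h ε hε
  refine ⟨l, ?_⟩
  filter_upwards [hl] with n ⟨d, e, hd, he, h1, h2, h3⟩
  refine ⟨e, d, he, hd, h2, h1, ?_⟩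
  have h4 : (θ n)⁻¹ ((τ n).π₁ e) - (τ n).π₁ d =
      (θ n).symm ((τ n).π₁ e - θ n ((τ n).π₁ d)) := by
    rw [map_sub, StarAlgEquiv.symm_apply_apply]; rfl
  rw [h4, StarAlgEquiv.norm_map, norm_sub_rev]
  exact h3

theorem of_tendsto (h : ∀ ε : ℝ, 0 < ε → ∃ b' c', LimitRel τ U θ b' c' ∧ ‖b' - b‖ < ε ∧
    ‖c' - c‖ < ε) : LimitRel τ U θ b c := by
  intro ε hε
  obtain ⟨b', c', h', hb, hc⟩ := h (ε / 2) (half_pos hε)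
  obtain ⟨l, hl⟩ := h' (ε / 2) (half_pos hε)
  refine ⟨l, ?_⟩
  filter_upwards [hl] with n ⟨d, e, hd, he, h1, h2, h3⟩
  refine ⟨d, e, hd, he, ?_, ?_, by linarith⟩
  · linarith [norm_sub_le_norm_sub_add_norm_sub ((τ n).π₂ d) b' b]
  · linarith [norm_sub_le_norm_sub_add_norm_sub ((τ n).π₂ e) c' c]

theorem congr (h : LimitRel τ U θ b c)
    (hθ : ∀ (l : ℝ≥0) (ε : ℝ), 0 < ε → ∀ᶠ n in (U : Filter ℕ), ∀ a, IsLip (A n) l a →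
      ‖θ n a - θ' n a‖ < ε) : LimitRel τ U θ' b c := by
  intro ε hε
  obtain ⟨l, hl⟩ := h (ε / 2) (half_pos hε)
  refine ⟨l, ?_⟩
  filter_upwards [hl, hθ l (ε / 2) (half_pos hε)] with n ⟨d, e, hd, he, h1, h2, h3⟩ h4
  refine ⟨d, e, hd, he, by linarith, by linarith, ?_⟩
  have := h4 _ ((τ n).isometry₁.isLip hd)
  rw [norm_sub_rev] at this
  linarith [norm_sub_le_norm_sub_add_norm_sub (θ' n ((τ n).π₁ d)) (θ n ((τ n).π₁ d)) ((τ n).π₁ e)]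

/-- Compare `(d, e)` with a pair `(d₀, e₀)` witnessing the relation. Differences are Lipschitz, so
their sizes pass from `B` to `A n` for `d - d₀`, then back for `e - e₀`. Each crossing costs a
factor 2, whence the 4; ten errors of `ε / 10` accumulate. -/
theorem norm_sub_le_of_isLip (hτ : Tendsto (fun n => (τ n).extent) U (𝓝 0))
    (h : LimitRel τ U θ b c) (l : ℝ≥0) {ε : ℝ} (hε : 0 < ε) :
    ∀ᶠ n in (U : Filter ℕ), ∀ d e : (τ n).D.carrier, IsLip (τ n).D l d → IsLip (τ n).D l e →
      ‖(τ n).π₂ e - c‖ ≤ 4 * ‖(τ n).π₂ d - b‖ + 2 * ‖θ n ((τ n).π₁ d) - (τ n).π₁ e‖ + ε := by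
  obtain ⟨l₀, hl₀⟩ := h (ε / 10) (by positivity)
  filter_upwards [hl₀, eventually_norm_le_of_isLip hτ (l + l₀) (ε := ε / 10) (by positivity)]
    with n ⟨d₀, e₀, hd₀, he₀, h1, h2, h3⟩ hn d e hd he
  have hd' := (hn _ (hd.sub hd₀)).2
  have he' := (hn _ (he.sub he₀)).1
  have k1 := NonUnitalStarAlgHom.norm_apply_le (τ n).π₁ (d - d₀)
  have k2 := NonUnitalStarAlgHom.norm_apply_le (τ n).π₂ (e - e₀)
  rw [map_sub] at hd' he' k1 k2
  have k3 : ‖θ n ((τ n).π₁ d) - θ n ((τ n).π₁ d₀)‖ = ‖(τ n).π₁ d - (τ n).π₁ d₀‖ := by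
    rw [← map_sub, StarAlgEquiv.norm_map]
  have k4 := norm_sub_le_norm_sub_add_norm_sub ((τ n).π₂ e) ((τ n).π₂ e₀) c
  have k5 := norm_sub_le_norm_sub_add_norm_sub ((τ n).π₂ d) b ((τ n).π₂ d₀)
  have k6 := norm_sub_le_norm_sub_add_norm_sub ((τ n).π₁ e) (θ n ((τ n).π₁ d)) ((τ n).π₁ e₀)
  have k7 := norm_sub_le_norm_sub_add_norm_sub (θ n ((τ n).π₁ d)) (θ n ((τ n).π₁ d₀))
    ((τ n).π₁ e₀)
  rw [norm_sub_rev b] at k5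
  rw [norm_sub_rev ((τ n).π₁ e) (θ n _)] at k6
  linarith

theorem norm_le (hτ : Tendsto (fun n => (τ n).extent) U (𝓝 0)) (h : LimitRel τ U θ b c) :
    ‖c‖ ≤ 4 * ‖b‖ := by
  refine le_of_forall_pos_le_add fun ε hε => ?_
  obtain ⟨n, hn⟩ := (h.norm_sub_le_of_isLip hτ 0 hε).exists
  have h0 : IsLip (τ n).D 0 0 := by simpa using IsLip.algebraMap (A := (τ n).D) 0
  simpa using hn 0 0 h0 h0

theorem unique (hτ : Tendsto (fun n => (τ n).extent) U (𝓝 0)) (h : LimitRel τ U θ b c)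
    (h' : LimitRel τ U θ b c') : c = c' := by
  refine eq_of_forall_dist_le fun ε hε => ?_
  obtain ⟨l, hl⟩ := h (ε / 8) (by positivity)
  obtain ⟨n, ⟨d, e, hd, he, h1, h2, h3⟩, hn⟩ :=
    (hl.and (h'.norm_sub_le_of_isLip hτ l (ε := ε / 8) (by positivity))).exists
  have h4 := hn d e hd he
  rw [dist_eq_norm]
  have h5 := norm_sub_le_norm_sub_add_norm_sub c ((τ n).π₂ e) c'
  rw [norm_sub_rev c ((τ n).π₂ e)] at h5
  linarith

/-- The end `e` of the first pair and the start `d'` of the second both approximate `c` in `B`.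
Being Lipschitz, they are then close in the tunnel, hence in `A n`. -/
theorem comp (hτ : Tendsto (fun n => (τ n).extent) U (𝓝 0)) {x : B.carrier}
    (h : LimitRel τ U θ b c) (h' : LimitRel τ U θ' c x) :
    LimitRel τ U (fun n => θ' n * θ n) b x := by
  intro ε hε
  obtain ⟨l, hl⟩ := h (ε / 8) (by positivity)
  obtain ⟨l', hl'⟩ := h' (ε / 8) (by positivity)
  refine ⟨l + l', ?_⟩
  filter_upwards [hl, hl', eventually_norm_le_of_isLip hτ (l + l') (ε := ε / 8) (by positivity)]
    with n ⟨d, e, hd, he, h1, h2, h3⟩ ⟨d', e', hd', he', h1', h2', h3'⟩ hn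
  refine ⟨d, e', hd.mono le_self_add, he'.mono le_add_self, by linarith, by linarith, ?_⟩
  have k1 := (hn _ (he.sub hd')).2
  have k2 := NonUnitalStarAlgHom.norm_apply_le (τ n).π₁ (e - d')
  rw [map_sub] at k1 k2
  have k3 := norm_sub_le_norm_sub_add_norm_sub ((τ n).π₂ e) c ((τ n).π₂ d')
  rw [norm_sub_rev c] at k3
  have k4 : ‖θ' n (θ n ((τ n).π₁ d)) - θ' n ((τ n).π₁ e)‖ = ‖θ n ((τ n).π₁ d) - (τ n).π₁ e‖ := by
    rw [← map_sub, StarAlgEquiv.norm_map]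
  have k5 : ‖θ' n ((τ n).π₁ e) - θ' n ((τ n).π₁ d')‖ = ‖(τ n).π₁ e - (τ n).π₁ d'‖ := by
    rw [← map_sub, StarAlgEquiv.norm_map]
  have k6 := norm_sub_le_norm_sub_add_norm_sub (θ' n (θ n ((τ n).π₁ d))) (θ' n ((τ n).π₁ e))
    ((τ n).π₁ e')
  have k7 := norm_sub_le_norm_sub_add_norm_sub (θ' n ((τ n).π₁ e)) (θ' n ((τ n).π₁ d'))
    ((τ n).π₁ e')
  rw [StarAlgEquiv.mul_apply]
  linarith

theorem _root_.norm_mul_sub_mul_lt {R : Type*} [NormedRing R] {x y x' y' : R} {M δ : ℝ}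
    (hx : ‖x - x'‖ < δ) (hy : ‖y - y'‖ < δ) (hyM : ‖y‖ ≤ M) (hxM : ‖x'‖ ≤ M) (hM : 0 < M) :
    ‖x * y - x' * y'‖ < 2 * M * δ := by
  have h : x * y - x' * y' = (x - x') * y + x' * (y - y') := by noncomm_ring
  rw [h]
  have h1 := norm_add_le ((x - x') * y) (x' * (y - y'))
  have h2 := norm_mul_le (x - x') y
  have h3 := norm_mul_le x' (y - y')
  have h4 : ‖x - x'‖ * ‖y‖ ≤ ‖x - x'‖ * M := by gcongr
  have h5 : ‖x'‖ * ‖y - y'‖ ≤ M * ‖y - y'‖ := by gcongr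
  have h6 : ‖x - x'‖ * M < δ * M := by gcongr
  have h7 : M * ‖y - y'‖ < M * δ := by gcongr
  linarith

theorem mul (hF : IsAdmissible F) (hF_finite : ∀ x y s t : ℝ≥0, F x y s t ≠ ⊤)
    (hτ : Tendsto (fun n => (τ n).extent) U (𝓝 0)) (h : LimitRel τ U θ b c)
    (h' : LimitRel τ U θ b' c') : LimitRel τ U θ (b * b') (c * c') := by
  intro ε hε
  -- Bounds all four lifts: for instance `‖d‖ ≤ 2 * ‖π₂ d‖ + 1` and `‖π₂ d‖ ≤ ‖b‖ + 1`.
  set M : ℝ≥0 := 2 * (‖b‖₊ + ‖c‖₊ + ‖b'‖₊ + ‖c'‖₊) + 3 with hM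
  have hMr : (M : ℝ) = 2 * (‖b‖ + ‖c‖ + ‖b'‖ + ‖c'‖) + 3 := by simp [hM]
  have hb0 := norm_nonneg b
  have hc0 := norm_nonneg c
  have hb0' := norm_nonneg b'
  have hc0' := norm_nonneg c'
  have hM0 : (0 : ℝ) < M := by rw [hMr]; positivity
  obtain ⟨δ, hδ, hδ1, hδε⟩ : ∃ δ : ℝ, 0 < δ ∧ δ ≤ 1 ∧ 2 * M * δ ≤ ε := by
    refine ⟨min 1 (ε / (2 * M)), by positivity, min_le_left _ _, ?_⟩
    calc 2 * M * min 1 (ε / (2 * M)) ≤ 2 * M * (ε / (2 * M)) := by gcongr; exact min_le_right _ _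
      _ = ε := by field_simp
  obtain ⟨l, hl⟩ := h δ hδ
  obtain ⟨l', hl'⟩ := h' δ hδ
  refine ⟨4 * (F M M ((l + l' : ℝ≥0)) ((l + l' : ℝ≥0))).toNNReal, ?_⟩
  filter_upwards [hl, hl', eventually_norm_le_of_isLip hτ (l + l') (ε := 1) one_pos]
    with n ⟨d, e, hd, he, h1, h2, h3⟩ ⟨d', e', hd', he', h1', h2', h3'⟩ hn
  replace hd := hd.mono (m := l + l') le_self_add
  replace he := he.mono (m := l + l') le_self_add
  replace hd' := hd'.mono (m := l + l') le_add_self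
  replace he' := he'.mono (m := l + l') le_add_self
  have b1 := norm_le_norm_add_norm_sub' ((τ n).π₂ d) b
  have b2 := norm_le_norm_add_norm_sub' ((τ n).π₂ e) c
  have b3 := norm_le_norm_add_norm_sub' ((τ n).π₂ d') b'
  have b4 := norm_le_norm_add_norm_sub' ((τ n).π₂ e') c'
  have hdM : ‖d‖ ≤ M := by linarith [(hn d hd).2]
  have heM : ‖e‖ ≤ M := by linarith [(hn e he).2]
  have hdM' : ‖d'‖ ≤ M := by linarith [(hn d' hd').2]
  have heM' : ‖e'‖ ≤ M := by linarith [(hn e' he').2]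
  refine ⟨d * d', e * e', hd.mul hF hF_finite hd' hdM hdM', he.mul hF hF_finite he' heM heM',
    ?_, ?_, ?_⟩
  · rw [map_mul]
    refine (norm_mul_sub_mul_lt h1 h1' ?_ ?_ hM0).trans_le hδε <;> linarith
  · rw [map_mul]
    refine (norm_mul_sub_mul_lt h2 h2' ?_ ?_ hM0).trans_le hδε <;> linarith
  · rw [map_mul, map_mul, map_mul]
    refine (norm_mul_sub_mul_lt h3 h3' ?_ ?_ hM0).trans_le hδε
    · rw [StarAlgEquiv.norm_map]
      exact (NonUnitalStarAlgHom.norm_apply_le (τ n).π₁ d').trans hdM'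
    · exact (NonUnitalStarAlgHom.norm_apply_le (τ n).π₁ e).trans heM

theorem smul (hF : IsAdmissible F) (hF_finite : ∀ x y s t : ℝ≥0, F x y s t ≠ ⊤)
    (hτ : Tendsto (fun n => (τ n).extent) U (𝓝 0)) (z : ℂ) (h : LimitRel τ U θ b c) :
    LimitRel τ U θ (z • b) (z • c) := by
  rw [Algebra.smul_def, Algebra.smul_def]
  exact (of_algebraMap z).mul hF hF_finite hτ h

end LimitRel

/-- Elements of finite Lipschitz seminorm have limits, which are tracked by lifts of controlled
Lipschitz seminorm. -/
theorem exists_limit_of_L_lt (hτ : Tendsto (fun n => (τ n).extent) U (𝓝 0))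
    (hθ : ∀ n a, (A n).L (autSelfAdjoint (θ n) a) ≤ (A n).L a) {x : selfAdjoint B.carrier}
    {l : ℝ≥0} (hx : B.L x < l) :
    ∃ y : selfAdjoint B.carrier, B.L y ≤ l ∧ LimitRel τ U θ (x : B.carrier) y ∧
      ∀ ε : ℝ, 0 < ε → ∀ᶠ n in (U : Filter ℕ),
      ∃ d e : selfAdjoint (τ n).D.carrier, (τ n).D.L d ≤ l ∧ (τ n).D.L e ≤ l ∧
        (τ n).π₂ d = (x : B.carrier) ∧ ‖(τ n).π₂ e - y‖ < ε ∧ (τ n).π₁ e = θ n ((τ n).π₁ d) := by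
  have hsa : ∀ {P Q : QQCMS.{u} F} (π : P.carrier →⋆ₐ[ℂ] Q.carrier) (d : selfAdjoint P.carrier),
      π (d : P.carrier) ∈ selfAdjoint Q.carrier := fun π d => d.2.map π
  choose d hd hdl using fun n => (τ n).isometry₂.exists_lift hx
  have hlift : ∀ n, ∃ e : selfAdjoint (τ n).D.carrier,
      (τ n).π₁ e = autSelfAdjoint (θ n) ⟨(τ n).π₁ (d n), hsa (τ n).π₁ (d n)⟩ ∧
      (τ n).D.L e < l := fun n =>
    (τ n).isometry₁.exists_lift (((hθ n _).trans ((τ n).isometry₁.L_le rfl)).trans_lt (hdl n))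
  choose e he hel using hlift
  let y : ℕ → selfAdjoint B.carrier := fun n => ⟨(τ n).π₂ (e n), hsa (τ n).π₂ (e n)⟩
  -- The tunnel errors, 1 for each crossing, account for the 2; the sequence thus eventually stays
  -- in one compact Lipschitz ball.
  have hmem : ∀ᶠ n in (U : Filter ℕ), y n ∈
      {a : selfAdjoint B.carrier | B.L a ≤ l ∧ ‖(a : B.carrier)‖ ≤ ‖(x : B.carrier)‖ + 2} := by
    filter_upwards [eventually_norm_le hτ l one_pos] with n hn
    refine ⟨((τ n).isometry₂.L_le rfl).trans (hel n).le, ?_⟩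
    have h1 := (hn _ (hel n).le).1
    have h2 := (hn _ (hdl n).le).2
    have h3 : ‖(τ n).π₁ (e n)‖ = ‖(τ n).π₁ (d n)‖ := by
      rw [he]; exact StarAlgEquiv.norm_map (θ n) _
    have h4 := NonUnitalStarAlgHom.norm_apply_le (τ n).π₁ (d n : (τ n).D.carrier)
    have h5 := NonUnitalStarAlgHom.norm_apply_le (τ n).π₂ (e n : (τ n).D.carrier)
    rw [hd] at h2
    change ‖(τ n).π₂ (e n)‖ ≤ _
    linarith
  obtain ⟨z, hz, hzU⟩ := isCompact_iff_ultrafilter_le_nhds.mp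
    (isCompact_lipBall B.isLSeminorm l (‖(x : B.carrier)‖ + 2)) (U.map y)
    (le_principal_iff.mpr hmem)
  suffices h : ∀ ε : ℝ, 0 < ε → ∀ᶠ n in (U : Filter ℕ),
      ∃ d e : selfAdjoint (τ n).D.carrier, (τ n).D.L d ≤ l ∧ (τ n).D.L e ≤ l ∧
        (τ n).π₂ d = (x : B.carrier) ∧ ‖(τ n).π₂ e - z‖ < ε ∧
        (τ n).π₁ e = θ n ((τ n).π₁ d) by
    refine ⟨z, hz.1, fun ε hε => ⟨l, ?_⟩, h⟩
    filter_upwards [h ε hε] with n ⟨d, e, hd, he, h1, h2, h3⟩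
    refine ⟨d, e, .of_selfAdjoint hd, .of_selfAdjoint he, ?_, h2, ?_⟩
    · rwa [h1, sub_self, norm_zero]
    · rwa [h3, sub_self, norm_zero]
  intro ε hε
  have hev : ∀ᶠ n in (U : Filter ℕ), y n ∈ Metric.ball z ε := hzU (Metric.ball_mem_nhds z hε)
  filter_upwards [hev] with n hn
  refine ⟨d n, e n, (hdl n).le, (hel n).le, hd n, ?_, he n⟩
  simpa [dist_eq_norm, Subtype.dist_eq] using hn

/-- The graph is a closed subspace on which the first projection is bounded below, so its range is
closed. It contains the self-adjoint elements of finite seminorm, which are dense among the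
self-adjoint ones. -/
theorem exists_limitRel (hF : IsAdmissible F) (hF_finite : ∀ x y s t : ℝ≥0, F x y s t ≠ ⊤)
    (hτ : Tendsto (fun n => (τ n).extent) U (𝓝 0))
    (hθ : ∀ n a, (A n).L (autSelfAdjoint (θ n) a) ≤ (A n).L a) (b : B.carrier) :
    ∃ c, LimitRel τ U θ b c := by
  let Γ : Submodule ℂ (B.carrier × B.carrier) :=
    { carrier := {p | LimitRel τ U θ p.1 p.2}
      add_mem' := fun hp hq => LimitRel.add hp hq
      zero_mem' := by simpa using LimitRel.of_algebraMap (τ := τ) (U := U) (θ := θ) 0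
      smul_mem' := fun z _ hp => LimitRel.smul hF hF_finite hτ z hp }
  have hcl : IsClosed (Γ : Set (B.carrier × B.carrier)) := by
    refine isClosed_of_closure_subset fun p hp => LimitRel.of_tendsto fun ε hε => ?_
    obtain ⟨q, hq, hpq⟩ := Metric.mem_closure_iff.mp hp ε hε
    rw [dist_comm, Prod.dist_eq, max_lt_iff, dist_eq_norm, dist_eq_norm] at hpq
    exact ⟨q.1, q.2, hq, hpq⟩
  have : CompleteSpace Γ := hcl.completeSpace_coe
  let f : Γ →L[ℂ] B.carrier := (ContinuousLinearMap.fst ℂ _ _).comp Γ.subtypeL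
  have hanti : AntilipschitzWith 4 f := by
    refine f.antilipschitz_of_bound fun p => ?_
    have h1 : ‖(p : B.carrier × B.carrier).2‖ ≤ 4 * ‖(p : B.carrier × B.carrier).1‖ :=
      LimitRel.norm_le hτ p.2
    have h0 := norm_nonneg (p : B.carrier × B.carrier).1
    change max ‖(p : B.carrier × B.carrier).1‖ ‖(p : B.carrier × B.carrier).2‖ ≤
      4 * ‖(p : B.carrier × B.carrier).1‖
    exact max_le (by linarith) h1
  have hrange : IsClosed (LinearMap.range f.toLinearMap : Set B.carrier) := by
    rw [LinearMap.coe_range]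
    exact hanti.isClosed_range f.uniformContinuous
  have hsub : ∀ x : selfAdjoint B.carrier, (x : B.carrier) ∈ LinearMap.range f.toLinearMap := by
    intro x
    rw [← SetLike.mem_coe, ← hrange.closure_eq, Metric.mem_closure_iff]
    intro ε hε
    obtain ⟨x', hx', hxx'⟩ := exists_lip_norm_sub_lt B x hε
    obtain ⟨l, hl⟩ := ENNReal.lt_iff_exists_nnreal_btwn.mp hx'.lt_top
    obtain ⟨y, -, hy, -⟩ := exists_limit_of_L_lt hτ hθ hl.1
    exact ⟨x', ⟨⟨(x', y), hy⟩, rfl⟩, by rwa [dist_eq_norm]⟩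
  have hb : b ∈ LinearMap.range f.toLinearMap := by
    rw [← realPart_add_I_smul_imaginaryPart b]
    exact add_mem (hsub _) (Submodule.smul_mem _ _ (hsub _))
  obtain ⟨p, rfl⟩ := hb
  exact ⟨_, p.2⟩

/-- The limit of a sequence of automorphisms along tunnels. -/
def limitAut (hF : IsAdmissible F) (hF_finite : ∀ x y s t : ℝ≥0, F x y s t ≠ ⊤)
    (hτ : Tendsto (fun n => (τ n).extent) U (𝓝 0))
    (θ : ∀ n, (A n).carrier ≃⋆ₐ[ℂ] (A n).carrier)
    (hθ : ∀ n a, (A n).L (autSelfAdjoint (θ n) a) ≤ (A n).L a)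
    (hθ' : ∀ n a, (A n).L (autSelfAdjoint (θ n)⁻¹ a) ≤ (A n).L a) :
    B.carrier ≃⋆ₐ[ℂ] B.carrier :=
  have h (b : B.carrier) := (exists_limitRel hF hF_finite hτ hθ b).choose_spec
  have h' (b : B.carrier) := (exists_limitRel hF hF_finite hτ hθ' b).choose_spec
  -- Every law holds because both sides are limits of the same element, and limits are unique.
  { toFun b := (exists_limitRel hF hF_finite hτ hθ b).choose
    invFun b := (exists_limitRel hF hF_finite hτ hθ' b).choose
    left_inv b := (h' _).unique hτ (h b).symm
    right_inv b := (h _).unique hτ (by simpa using (h' b).symm)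
    map_mul' b c := (h _).unique hτ ((h b).mul hF hF_finite hτ (h c))
    map_add' b c := (h _).unique hτ ((h b).add (h c))
    map_star' b := (h _).unique hτ (h b).star_star
    map_smul' z b := (h _).unique hτ ((h b).smul hF hF_finite hτ z) }

theorem limitRel_limitAut (hF : IsAdmissible F) (hF_finite : ∀ x y s t : ℝ≥0, F x y s t ≠ ⊤)
    (hτ : Tendsto (fun n => (τ n).extent) U (𝓝 0))
    (hθ : ∀ n a, (A n).L (autSelfAdjoint (θ n) a) ≤ (A n).L a)
    (hθ' : ∀ n a, (A n).L (autSelfAdjoint (θ n)⁻¹ a) ≤ (A n).L a) (b : B.carrier) :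
    LimitRel τ U θ b (limitAut hF hF_finite hτ θ hθ hθ' b) :=
  (exists_limitRel hF hF_finite hτ hθ b).choose_spec

end LimitRel

/-! ### Averaging over a compact group -/

section Average

open MeasureTheory

/-- An almost invariant element for an ergodic action of a compact group is almost scalar. -/
theorem exists_norm_sub_algebraMap_le {H A : Type*} [Group H] [TopologicalSpace H]
    [IsTopologicalGroup H] [CompactSpace H] [CStarAlgebra A] {α : H →* (A ≃⋆ₐ[ℂ] A)}
    (hα : IsStronglyContinuous α) (herg : IsErgodicAction α) {a : A} {ε : ℝ}
    (ha : ∀ h, ‖α h a - a‖ ≤ ε) : ∃ z : ℂ, ‖a - algebraMap ℂ A z‖ ≤ ε := by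
  borelize H
  let μ : Measure H := Measure.haarMeasure ⊤
  have hμ : IsProbabilityMeasure μ := ⟨by
    simpa using Measure.haarMeasure_self (K₀ := (⊤ : TopologicalSpace.PositiveCompacts H))⟩
  have hint : Integrable (fun h => α h a) μ :=
    (hα a).integrable_of_hasCompactSupport (HasCompactSupport.of_compactSpace _)
  -- Left invariance of Haar measure makes the average of the orbit a fixed point, hence a scalar by
  -- ergodicity.
  have hfix : ∀ k, α k (∫ h, α h a ∂μ) = ∫ h, α h a ∂μ := by
    intro k
    let T : A →L[ℂ] A :=
      { toFun := α k
        map_add' := map_add _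
        map_smul' := map_smul _
        cont := (StarAlgEquiv.isometry (α k)).continuous }
    have h1 : T (∫ h, α h a ∂μ) = ∫ h, T (α h a) ∂μ := (T.integral_comp_comm hint).symm
    have h2 : ∀ h, T (α h a) = α (k * h) a := fun h => by rw [map_mul]; rfl
    change T (∫ h, α h a ∂μ) = _
    rw [h1]
    simp_rw [h2]
    exact integral_mul_left_eq_self (fun h => α h a) k
  have hmem : (∫ h, α h a ∂μ) ∈ {a : A | ∀ h, α h a = a} := hfix
  rw [herg] at hmem
  obtain ⟨z, hz⟩ := hmem
  refine ⟨z, ?_⟩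
  have h3 : (∫ h, (α h a - a) ∂μ) = algebraMap ℂ A z - a := by
    rw [integral_sub hint (integrable_const a), ← hz]
    simp
  rw [norm_sub_rev, ← h3]
  refine (norm_integral_le_of_norm_le_const (Eventually.of_forall ha)).trans ?_
  simp

end Average

/-! ### Limits of subgroups -/

/-- Test the hypothesis on a family of counterexamples, chosen wherever one exists. This reduces
uniform statements over `H n` to single sequences, which have limits. -/
theorem _root_.Filter.eventually_forall_of_forall_eventually {ι : Type*} {α : ι → Type*}
    [∀ i, Nonempty (α i)] {l : Filter ι} {P : ∀ i, α i → Prop}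
    (h : ∀ x : ∀ i, α i, ∀ᶠ i in l, P i (x i)) : ∀ᶠ i in l, ∀ a, P i a := by
  have key : ∀ i, ∃ a, P i a → ∀ a, P i a := fun i => by
    by_cases hi : ∀ a, P i a
    · exact ⟨Classical.arbitrary _, fun _ => hi⟩
    · obtain ⟨a, ha⟩ := not_forall.mp hi
      exact ⟨a, fun h => absurd h ha⟩
  choose x hx using key
  exact (h x).mono hx

namespace IsLengthFunction

variable {G : Type*} [Group G] {ℓ : G → ℝ≥0}

theorem inv_mul_comm (hℓ : IsLengthFunction ℓ) (g h : G) : ℓ (g⁻¹ * h) = ℓ (h⁻¹ * g) := by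
  rw [← hℓ.inv, mul_inv_rev, inv_inv]

theorem inv_mul_le (hℓ : IsLengthFunction ℓ) (g h k : G) :
    ℓ (g⁻¹ * k) ≤ ℓ (g⁻¹ * h) + ℓ (h⁻¹ * k) := by
  simpa [mul_assoc] using hℓ.mul_le (g⁻¹ * h) (h⁻¹ * k)

/-- Conjugation invariance absorbs the conjugate of `g⁻¹ * h` by `g'⁻¹`; this is what makes limits
of products multiplicative. -/
theorem mul_inv_mul_le (hℓ : IsLengthFunction ℓ) (hconj : ∀ g h : G, ℓ (h * g * h⁻¹) = ℓ g)
    (g g' h h' : G) : ℓ ((g * g')⁻¹ * (h * h')) ≤ ℓ (g⁻¹ * h) + ℓ (g'⁻¹ * h') := by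
  have h1 : (g * g')⁻¹ * (h * h') = g'⁻¹ * (g⁻¹ * h) * g'⁻¹⁻¹ * (g'⁻¹ * h') := by group
  rw [h1]
  refine (hℓ.mul_le _ _).trans ?_
  rw [hconj]

end IsLengthFunction

section LimitSubgroup

variable {G : Type*} [Group G] {ℓ : G → ℝ≥0} {H : ℕ → Subgroup G}
  {U : Ultrafilter ℕ}

/-- The limit along an ultrafilter of a sequence of subgroups. -/
def limitSet (ℓ : G → ℝ≥0) (H : ℕ → Subgroup G) (U : Ultrafilter ℕ) : Set G :=
  {g | ∀ ε : ℝ≥0, 0 < ε → ∀ᶠ n in (U : Filter ℕ), ∃ k ∈ H n, ℓ (k⁻¹ * g) < ε}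

theorem mem_limitSet_of_tendsto {x : ∀ n, H n} {g : G}
    (h : Tendsto (fun n => ℓ ((x n : G)⁻¹ * g)) U (𝓝 0)) : g ∈ limitSet ℓ H U := fun ε hε => by
  filter_upwards [h.eventually_lt_const hε] with n hn
  exact ⟨x n, (x n).2, hn⟩

variable [TopologicalSpace G] [IsTopologicalGroup G]

theorem exists_tendsto_length [CompactSpace G] (hℓ : IsLengthFunction ℓ) (hℓc : Continuous ℓ)
    (x : ℕ → G) : ∃ g, Tendsto x U (𝓝 g) ∧ Tendsto (fun n => ℓ ((x n)⁻¹ * g)) U (𝓝 0) := by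
  obtain ⟨g, -, hg⟩ := isCompact_iff_ultrafilter_le_nhds.mp (isCompact_univ (X := G)) (U.map x)
    (by simp)
  have h1 : Tendsto x U (𝓝 g) := hg
  refine ⟨g, h1, ?_⟩
  have h2 : Tendsto (fun n => ℓ ((x n)⁻¹ * g)) U (𝓝 (ℓ (g⁻¹ * g))) :=
    (hℓc.tendsto _).comp (h1.inv.mul_const g)
  simpa [(hℓ.eq_zero_iff 1).mpr rfl] using h2

theorem isClosed_limitSet (hℓ : IsLengthFunction ℓ) (hℓc : Continuous ℓ) :
    IsClosed (limitSet ℓ H U) := by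
  refine isClosed_of_closure_subset fun g hg ε hε => ?_
  have hopen : IsOpen {g' | ℓ (g'⁻¹ * g) < ε / 2} :=
    isOpen_lt (hℓc.comp (continuous_inv.mul continuous_const)) continuous_const
  obtain ⟨g', hg', hg'K⟩ := mem_closure_iff.mp hg _ hopen (by
    simpa [(hℓ.eq_zero_iff 1).mpr rfl] using hε)
  filter_upwards [hg'K (ε / 2) (half_pos hε)] with n ⟨k, hk, hkg⟩
  refine ⟨k, hk, (hℓ.inv_mul_le k g' g).trans_lt ?_⟩
  calc _ < ε / 2 + ε / 2 := add_lt_add hkg hg'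
    _ = ε := add_halves ε

theorem tendsto_hausdorffDist_limitSet [CompactSpace G] (hℓ : IsLengthFunction ℓ)
    (hℓc : Continuous ℓ) :
    Tendsto (fun n => hausdorffDist (lengthDist ℓ) (H n : Set G) (limitSet ℓ H U)) U (𝓝 0) := by
  refine ENNReal.tendsto_nhds_zero.mpr fun ε' hε' => ?_
  obtain ⟨ε, hε, hεε'⟩ : ∃ ε : ℝ≥0, 0 < ε ∧ (ε : ℝ≥0∞) ≤ ε' := by
    obtain ⟨ε, h1, h2⟩ := ENNReal.lt_iff_exists_nnreal_btwn.mp hε'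
    exact ⟨ε, by exact_mod_cast h1, h2.le⟩
  have h1 : ∀ᶠ n in (U : Filter ℕ), ∀ x : H n, ∃ y ∈ limitSet ℓ H U, ℓ (y⁻¹ * x) < ε := by
    refine eventually_forall_of_forall_eventually fun x => ?_
    obtain ⟨g, -, hg⟩ := exists_tendsto_length (U := U) hℓ hℓc fun n => (x n : G)
    filter_upwards [hg.eventually_lt_const hε] with n hn
    exact ⟨g, mem_limitSet_of_tendsto hg, by rwa [hℓ.inv_mul_comm]⟩
  have hne : Nonempty (limitSet ℓ H U) := ⟨1, fun ε hε => Eventually.of_forall fun n =>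
    ⟨1, one_mem _, by simpa [(hℓ.eq_zero_iff 1).mpr rfl] using hε⟩⟩
  have h2 : ∀ᶠ n in (U : Filter ℕ), ∀ y : limitSet ℓ H U, ∃ x ∈ H n, ℓ (x⁻¹ * y) < ε := by
    refine eventually_forall_of_forall_eventually fun y => ?_
    obtain ⟨g, hyg, hg⟩ := exists_tendsto_length (U := U) hℓ hℓc fun n => (y n : G)
    have hgK : g ∈ limitSet ℓ H U := (isClosed_limitSet hℓ hℓc).mem_of_tendsto hyg
      (Eventually.of_forall fun n => (y n).2)
    filter_upwards [hg.eventually_lt_const (half_pos hε), hgK (ε / 2) (half_pos hε)]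
      with n hn ⟨k, hk, hkg⟩
    refine ⟨k, hk, (hℓ.inv_mul_le k g (y n)).trans_lt ?_⟩
    rw [hℓ.inv_mul_comm g]
    calc _ < ε / 2 + ε / 2 := add_lt_add hkg hn
      _ = ε := add_halves ε
  filter_upwards [h1, h2] with n hn1 hn2
  refine (max_le (iSup₂_le fun x hx => ?_) (iSup₂_le fun y hy => ?_)).trans hεε'
  · obtain ⟨y, hy, hxy⟩ := hn1 ⟨x, hx⟩
    exact (iInf₂_le y hy).trans (ENNReal.coe_le_coe.mpr hxy.le)
  · obtain ⟨x, hx, hxy⟩ := hn2 ⟨y, hy⟩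
    exact (iInf₂_le x hx).trans (ENNReal.coe_le_coe.mpr hxy.le)

theorem exists_mem_coe_eq_limitSet [CompactSpace G] (hℓ : IsLengthFunction ℓ)
    (hℓc : Continuous ℓ) {𝒢 : Set (Subgroup G)} (h𝒢 : IsHausdorffClosed ℓ 𝒢)
    (hH : ∀ n, H n ∈ 𝒢) : ∃ H' ∈ 𝒢, (H' : Set G) = limitSet ℓ H U := by
  have h := tendsto_hausdorffDist_limitSet (H := H) (U := U) hℓ hℓc
  -- Closedness of `𝒢` concerns ordinary sequences, so indices are picked at distance at most `1 /
  -- k`; they need not increase.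
  have h1 : ∀ k : ℕ, ∃ n, hausdorffDist (lengthDist ℓ) (H n : Set G) (limitSet ℓ H U) ≤
      (k : ℝ≥0∞)⁻¹ := fun k =>
    ((ENNReal.tendsto_nhds_zero.mp h) _ (by simp)).exists
  choose n hn using h1
  exact h𝒢 _ (fun k => H (n k)) (isClosed_limitSet hℓ hℓc) (fun k => hH _)
    (tendsto_of_tendsto_of_tendsto_of_le_of_le tendsto_const_nhds
      ENNReal.tendsto_inv_nat_nhds_zero (fun _ => zero_le) hn)

/-- A nearest point of the compact set `H n` serves every `ε` simultaneously. -/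
theorem exists_tendsto_of_mem_limitSet [CompactSpace G] (hℓc : Continuous ℓ)
    (hH : ∀ n, IsClosed (H n : Set G)) {g : G} (hg : g ∈ limitSet ℓ H U) :
    ∃ x : ∀ n, H n, Tendsto (fun n => ℓ ((x n : G)⁻¹ * g)) U (𝓝 0) := by
  have h1 : ∀ n, ∃ x : H n, ∀ k ∈ H n, ℓ ((x : G)⁻¹ * g) ≤ ℓ (k⁻¹ * g) := fun n => by
    obtain ⟨x, hx, hmin⟩ := (hH n).isCompact.exists_isMinOn ⟨1, one_mem (H n)⟩
      (f := fun x => ℓ (x⁻¹ * g))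
      (hℓc.comp (continuous_inv.mul continuous_const)).continuousOn
    exact ⟨⟨x, hx⟩, fun k hk => hmin hk⟩
  choose x hx using h1
  refine ⟨x, tendsto_order.mpr ⟨fun a ha => absurd ha not_lt_zero, fun ε hε => ?_⟩⟩
  filter_upwards [hg ε hε] with n ⟨k, hk, hkg⟩
  exact (hx n k hk).trans_lt hkg

end LimitSubgroup

theorem _root_.ENNReal.le_of_forall_lt_coe_imp_le {x y : ℝ≥0∞} (h : ∀ l : ℝ≥0, y < l → x ≤ l) :
    x ≤ y :=
  le_of_forall_gt_imp_ge_of_dense fun z hz => by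
    obtain ⟨l, h1, h2⟩ := ENNReal.lt_iff_exists_nnreal_btwn.mp hz
    exact (h l h1).trans h2.le

theorem exists_isLip_norm_sub_lt (A : QQCMS.{u} F) (a : A.carrier) {ε : ℝ} (hε : 0 < ε) :
    ∃ (a' : A.carrier) (l : ℝ≥0), IsLip A l a' ∧ ‖a - a'‖ < ε := by
  obtain ⟨x, hx, hxa⟩ := exists_lip_norm_sub_lt A (realPart a) (half_pos hε)
  obtain ⟨y, hy, hya⟩ := exists_lip_norm_sub_lt A (imaginaryPart a) (half_pos hε)
  lift A.L x to ℝ≥0 using hx with l hl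
  lift A.L y to ℝ≥0 using hy with m hm
  refine ⟨x + Complex.I • (y : A.carrier), l + m,
    (IsLip.of_selfAdjoint hl.ge).add (IsLip.of_selfAdjoint hm.ge).I_smul, ?_⟩
  have h : a - (x + Complex.I • (y : A.carrier)) = ((realPart a : A.carrier) - x) +
      Complex.I • ((imaginaryPart a : A.carrier) - y) := by
    conv_lhs => rw [← realPart_add_I_smul_imaginaryPart a]
    rw [smul_sub]; abel
  rw [h]
  refine (norm_add_le _ _).trans_lt ?_
  rw [norm_smul, Complex.norm_I, one_mul]
  linarith

/-! ### Lipschitz actions -/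

section LipAction

variable {G : Type*} [Group G] {ℓ : G → ℝ≥0} {H : Subgroup G} {A : QQCMS.{u} F}
  {α : H →* (A.carrier ≃⋆ₐ[ℂ] A.carrier)}

/-- The L-seminorm dominates the seminorm defined by the action and the length function. -/
def IsDominating (ℓ : G → ℝ≥0) (A : QQCMS.{u} F) (α : H →* (A.carrier ≃⋆ₐ[ℂ] A.carrier)) : Prop :=
  ∀ a : selfAdjoint A.carrier,
    (⨆ (h : H) (_ : h ≠ 1), ‖(a : A.carrier) - α h a‖ₑ / (ℓ h : ℝ≥0∞)) ≤ A.L a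

theorem isDominating_iff (hℓ : IsLengthFunction ℓ) : IsDominating ℓ A α ↔
    ∀ (a : selfAdjoint A.carrier) (l : ℝ≥0), A.L a < l → ∀ h : H,
      ‖(a : A.carrier) - α h a‖ ≤ l * ℓ h := by
  have hcoe : ∀ (x : A.carrier) (l m : ℝ≥0), ‖x‖ₑ ≤ (l : ℝ≥0∞) * m ↔ ‖x‖ ≤ l * m := by
    intro x l m
    rw [enorm_eq_nnnorm, ← ENNReal.coe_mul, ENNReal.coe_le_coe, ← NNReal.coe_le_coe]
    simp
  have hne : ∀ h : H, h ≠ 1 → (ℓ h : ℝ≥0∞) ≠ 0 := fun h hh h0 =>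
    hh (Subtype.ext ((hℓ.eq_zero_iff _).mp (by exact_mod_cast h0)))
  constructor
  · intro hd a l hl h
    by_cases hh : h = 1
    · simp [hh]; positivity
    have h1 : ‖(a : A.carrier) - α h a‖ₑ / (ℓ h : ℝ≥0∞) ≤ l :=
      (le_iSup₂ (f := fun (h : H) (_ : h ≠ 1) => ‖(a : A.carrier) - α h a‖ₑ / (ℓ h : ℝ≥0∞)) h
        hh).trans ((hd a).trans hl.le)
    rw [ENNReal.div_le_iff (hne h hh) ENNReal.coe_ne_top] at h1
    exact (hcoe _ _ _).mp h1
  · intro hd a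
    refine iSup₂_le fun h hh => ENNReal.le_of_forall_lt_coe_imp_le fun l hl => ?_
    rw [ENNReal.div_le_iff (hne h hh) ENNReal.coe_ne_top]
    exact (hcoe _ _ _).mpr (hd a l hl h)

theorem IsDominating.norm_sub_le (hℓ : IsLengthFunction ℓ) (hα : IsDominating ℓ A α)
    {a : A.carrier} {l m : ℝ≥0} (ha : IsLip A l a) (hlm : l < m) (h : H) :
    ‖a - α h a‖ ≤ 2 * m * ℓ h := by
  have hlm' : (l : ℝ≥0∞) < m := by exact_mod_cast hlm
  have h1 := (isDominating_iff hℓ).mp hα _ _ (ha.1.trans_lt hlm') h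
  have h2 := (isDominating_iff hℓ).mp hα _ _ (ha.2.trans_lt hlm') h
  have h3 : a - α h a = ((realPart a : A.carrier) - α h (realPart a : A.carrier)) +
      Complex.I • ((imaginaryPart a : A.carrier) - α h (imaginaryPart a : A.carrier)) := by
    conv_lhs => rw [← realPart_add_I_smul_imaginaryPart a]
    rw [map_add, map_smul, smul_sub]; abel
  rw [h3]
  refine (norm_add_le _ _).trans ?_
  rw [norm_smul, Complex.norm_I, one_mul]
  linarith

theorem IsDominating.norm_sub_apply_le (hℓ : IsLengthFunction ℓ) (hα : IsDominating ℓ A α)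
    {a : A.carrier} {l m : ℝ≥0} (ha : IsLip A l a) (hlm : l < m) (h k : H) :
    ‖α h a - α k a‖ ≤ 2 * m * ℓ ((h : G)⁻¹ * k) := by
  have h1 : α h a - α k a = α h (a - α (h⁻¹ * k) a) := by
    rw [map_sub, ← StarAlgEquiv.mul_apply, ← map_mul, mul_inv_cancel_left]
  rw [h1, StarAlgEquiv.norm_map]
  exact hα.norm_sub_le hℓ ha hlm (h⁻¹ * k)

/-- Orbit maps of Lipschitz elements are Lipschitz for `ℓ`; density and isometry of the
automorphisms extend continuity to all elements. -/
theorem IsDominating.isStronglyContinuous [TopologicalSpace G] [IsTopologicalGroup G]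
    (hℓ : IsLengthFunction ℓ) (hℓc : Continuous ℓ) (hα : IsDominating ℓ A α) :
    IsStronglyContinuous α := by
  refine fun a => continuous_iff_continuousAt.mpr fun k => ?_
  refine Metric.tendsto_nhds.mpr fun ε hε => ?_
  obtain ⟨a', l, hl, ha'⟩ := exists_isLip_norm_sub_lt A a (ε := ε / 4) (by positivity)
  have hcont : Continuous fun h : H => 2 * ((l + 1 : ℝ≥0) : ℝ) * ℓ ((h : G)⁻¹ * k) := by
    fun_prop
  have hlim := hcont.tendsto k
  simp only [inv_mul_cancel, (hℓ.eq_zero_iff 1).mpr rfl, NNReal.coe_zero, mul_zero] at hlim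
  filter_upwards [hlim.eventually_lt_const (show 0 < ε / 4 by positivity)] with h hh
  have h1 := hα.norm_sub_apply_le hℓ hl (lt_add_one l) h k
  have h2 : ‖α h a - α h a'‖ = ‖a - a'‖ := by rw [← map_sub, StarAlgEquiv.norm_map]
  have h3 : ‖α k a' - α k a‖ = ‖a - a'‖ := by
    rw [← map_sub, StarAlgEquiv.norm_map, norm_sub_rev]
  rw [dist_eq_norm]
  have h4 := norm_sub_le_norm_sub_add_norm_sub (α h a) (α h a') (α k a)
  have h5 := norm_sub_le_norm_sub_add_norm_sub (α h a') (α k a') (α k a)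
  linarith

theorem IsLip.aut {θ : A.carrier ≃⋆ₐ[ℂ] A.carrier}
    (hθ : ∀ a, A.L (autSelfAdjoint θ a) ≤ A.L a) {a : A.carrier} {l : ℝ≥0} (ha : IsLip A l a) :
    IsLip A l (θ a) := by
  have h1 : realPart (θ a) = autSelfAdjoint θ (realPart a) :=
    Subtype.ext (map_realPart (θ : A.carrier →⋆ₐ[ℂ] A.carrier) a).symm
  have h2 : imaginaryPart (θ a) = autSelfAdjoint θ (imaginaryPart a) :=
    Subtype.ext (map_imaginaryPart (θ : A.carrier →⋆ₐ[ℂ] A.carrier) a).symm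
  rw [IsLip, h1, h2]
  exact ⟨(hθ _).trans ha.1, (hθ _).trans ha.2⟩

end LipAction

/-! ### Limits of Lipschitz ergodic actions -/

section LimitAction

variable {G : Type*} [Group G]
  {ℓ : G → ℝ≥0} {H : ℕ → Subgroup G} {K : Subgroup G}
  {A : ℕ → QQCMS.{u} F} {B : QQCMS.{u} F} {τ : ∀ n, Tunnel (A n) B} {U : Ultrafilter ℕ}
  {α : ∀ n, H n →* ((A n).carrier ≃⋆ₐ[ℂ] (A n).carrier)}

/-- Asymptotically equal group elements act uniformly closely on Lipschitz balls, so the limit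
depends on `g` and not on the sequence approximating it. -/
theorem LimitRel.congr_of_tendsto (hℓ : IsLengthFunction ℓ)
    (hα : ∀ n, IsDominating ℓ (A n) (α n)) {x y : ∀ n, H n}
    (hxy : Tendsto (fun n => ℓ ((x n : G)⁻¹ * y n)) U (𝓝 0)) {b c : B.carrier}
    (h : LimitRel τ U (fun n => α n (x n)) b c) : LimitRel τ U (fun n => α n (y n)) b c := by
  refine h.congr fun l ε hε => ?_
  have hlim : Tendsto (fun n => 2 * ((l + 1 : ℝ≥0) : ℝ) * (ℓ ((x n : G)⁻¹ * y n) : ℝ)) U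
      (𝓝 (2 * ((l + 1 : ℝ≥0) : ℝ) * ((0 : ℝ≥0) : ℝ))) :=
    ((NNReal.continuous_coe.tendsto _).comp hxy).const_mul _
  rw [NNReal.coe_zero, mul_zero] at hlim
  filter_upwards [hlim.eventually_lt_const hε] with n hn a ha
  exact ((hα n).norm_sub_apply_le hℓ ha (lt_add_one l) (x n) (y n)).trans_lt hn

theorem limit_action_lipschitz (hℓ : IsLengthFunction ℓ)
    (hτ : Tendsto (fun n => (τ n).extent) U (𝓝 0))
    (hα : ∀ n, IsDominating ℓ (A n) (α n))
    (hαL : ∀ n h a, (A n).L (autSelfAdjoint (α n h) a) ≤ (A n).L a)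
    {θ : B.carrier ≃⋆ₐ[ℂ] B.carrier} {g : G} {x : ∀ n, H n}
    (hx : Tendsto (fun n => ℓ ((x n : G)⁻¹ * g)) U (𝓝 0))
    (hθ : ∀ b, LimitRel τ U (fun n => α n (x n)) b (θ b)) {b : selfAdjoint B.carrier} {l : ℝ≥0}
    (hb : B.L b < l) :
    B.L (autSelfAdjoint θ b) ≤ l ∧ ‖(b : B.carrier) - θ b‖ ≤ l * ℓ g := by
  -- The room between `m` and `l` yields the strict inequality that `isDominating_iff` asks of lifts
  -- of seminorm at most `m`.
  obtain ⟨m, hbm, hml⟩ := ENNReal.lt_iff_exists_nnreal_btwn.mp hb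
  obtain ⟨y, hy, hyR, hyd⟩ := exists_limit_of_L_lt hτ (fun n => hαL n (x n)) hbm
  have hyθ : (y : B.carrier) = θ b := hyR.unique hτ (hθ b)
  refine ⟨?_, ?_⟩
  · have : autSelfAdjoint θ b = y := Subtype.ext hyθ.symm
    rw [this]
    exact hy.trans hml.le
  rw [← hyθ]
  refine le_of_forall_pos_le_add fun ε hε => ?_
  -- The errors are `η` from the tunnel, `η` from the limit and `l * η` from `ℓ (x n)`, with one `η`
  -- to spare.
  have hε' : 0 < ε / (3 + l) := by positivity
  set η := ε / (3 + l) with hη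
  have hlim : Tendsto (fun n => (ℓ ((x n : G)⁻¹ * g) : ℝ)) U (𝓝 ((0 : ℝ≥0) : ℝ)) :=
    (NNReal.continuous_coe.tendsto _).comp hx
  obtain ⟨n, ⟨d, e, hd, he, h1, h2, h3⟩, hn, hxn⟩ :=
    ((hyd η hε').and ((eventually_norm_le hτ (m + m) hε').and
      (hlim.eventually_lt_const hε'))).exists
  have k1 := (hn (d - e) (((τ n).D.isLSeminorm.sub_le d e).trans
    (by rw [ENNReal.coe_add]; exact add_le_add hd he))).1
  have k2 := NonUnitalStarAlgHom.norm_apply_le (τ n).π₂ ((d - e : selfAdjoint _) : (τ n).D.carrier)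
  rw [AddSubgroupClass.coe_sub, map_sub, h3] at k1
  rw [AddSubgroupClass.coe_sub, map_sub, h1] at k2
  have hdsa : IsSelfAdjoint ((τ n).π₁ d) := d.2.map (τ n).π₁
  have k3 : ‖(τ n).π₁ d - α n (x n) ((τ n).π₁ d)‖ ≤ l * ℓ (x n) :=
    (isDominating_iff hℓ).mp (hα n) ⟨_, hdsa⟩ l
      ((((τ n).isometry₁.L_le rfl).trans hd).trans_lt hml) (x n)
  have k4 : (ℓ (x n) : ℝ) ≤ ℓ g + ℓ ((x n : G)⁻¹ * g) := by
    have h := hℓ.mul_le g ((x n : G)⁻¹ * g)⁻¹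
    rw [hℓ.inv] at h
    have h' : g * ((x n : G)⁻¹ * g)⁻¹ = x n := by group
    rw [h'] at h
    exact_mod_cast h
  have k5 : (l : ℝ) * ℓ (x n) ≤ l * (ℓ g + η) := by gcongr; linarith
  have k6 := norm_sub_le_norm_sub_add_norm_sub (b : B.carrier) ((τ n).π₂ e) y
  have k7 : (3 + l) * η = ε := by rw [hη]; field_simp
  linarith

variable [TopologicalSpace G] [IsTopologicalGroup G] [CompactSpace G]

/-- Limits of the automorphisms in the actions of the groups `H n` form an action on `B` of the
limit of these groups. -/
theorem exists_limit_action (hF : IsAdmissible F) (hF_finite : ∀ x y s t : ℝ≥0, F x y s t ≠ ⊤)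
    (hℓ : IsLengthFunction ℓ) (hℓc : Continuous ℓ) (hconj : ∀ g h : G, ℓ (h * g * h⁻¹) = ℓ g)
    (hH : ∀ n, IsClosed (H n : Set G)) (hK : (K : Set G) = limitSet ℓ H U)
    (hτ : Tendsto (fun n => (τ n).extent) U (𝓝 0))
    (hα : ∀ n, IsDominating ℓ (A n) (α n))
    (hαL : ∀ n h a, (A n).L (autSelfAdjoint (α n h) a) ≤ (A n).L a) :
    ∃ β : K →* (B.carrier ≃⋆ₐ[ℂ] B.carrier), ∀ (g : K) (x : ∀ n, H n),
      Tendsto (fun n => ℓ ((x n : G)⁻¹ * g)) U (𝓝 0) →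
      ∀ b, LimitRel τ U (fun n => α n (x n)) b (β g b) := by
  have hs : ∀ g : K, ∃ x : ∀ n, H n, Tendsto (fun n => ℓ ((x n : G)⁻¹ * g)) U (𝓝 0) := fun g =>
    exists_tendsto_of_mem_limitSet hℓc hH (hK ▸ g.2)
  choose s hs using hs
  let β : K → (B.carrier ≃⋆ₐ[ℂ] B.carrier) := fun g =>
    limitAut hF hF_finite hτ (fun n => α n (s g n)) (fun n => hαL n _)
      (fun n a => by rw [← map_inv]; exact hαL n _ a)
  have hβ : ∀ (g : K) (x : ∀ n, H n), Tendsto (fun n => ℓ ((x n : G)⁻¹ * g)) U (𝓝 0) →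
      ∀ b, LimitRel τ U (fun n => α n (x n)) b (β g b) := by
    intro g x hx b
    refine LimitRel.congr_of_tendsto hℓ hα (x := s g) ?_ (limitRel_limitAut hF hF_finite hτ _ _ b)
    have h0 : Tendsto (fun n => ℓ ((s g n : G)⁻¹ * g) + ℓ ((x n : G)⁻¹ * g)) U (𝓝 (0 + 0)) :=
      (hs g).add hx
    rw [add_zero] at h0
    refine tendsto_of_tendsto_of_tendsto_of_le_of_le tendsto_const_nhds h0 (fun _ => zero_le)
      fun n => ?_
    dsimp only
    rw [hℓ.inv_mul_comm (x n : G) g]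
    exact hℓ.inv_mul_le _ _ _
  refine ⟨MonoidHom.mk' β fun g k => StarAlgEquiv.ext fun b => ?_, hβ⟩
  have h1 := (hβ k _ (hs k) b).comp hτ (hβ g _ (hs g) (β k b))
  -- Products of approximants approximate `g * k`, so composing the two limits gives another limit
  -- of the same element.
  have h2 := hβ (g * k) (fun n => s g n * s k n) ?_ b
  · simp only [map_mul] at h2
    exact h2.unique hτ h1
  · have h0 : Tendsto (fun n => ℓ ((s g n : G)⁻¹ * g) + ℓ ((s k n : G)⁻¹ * k)) U (𝓝 (0 + 0)) :=
      (hs g).add (hs k)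
    rw [add_zero] at h0
    exact tendsto_of_tendsto_of_tendsto_of_le_of_le tendsto_const_nhds h0 (fun _ => zero_le)
      fun n => hℓ.mul_inv_mul_le hconj _ _ _ _

theorem isErgodicAction_of_limit (hℓ : IsLengthFunction ℓ) (hℓc : Continuous ℓ)
    (hH : ∀ n, IsClosed (H n : Set G)) (hK : (K : Set G) = limitSet ℓ H U)
    (hτ : Tendsto (fun n => (τ n).extent) U (𝓝 0))
    (hα : ∀ n, IsDominating ℓ (A n) (α n))
    (hαL : ∀ n h a, (A n).L (autSelfAdjoint (α n h) a) ≤ (A n).L a)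
    (herg : ∀ n, IsErgodicAction (α n)) {β : K →* (B.carrier ≃⋆ₐ[ℂ] B.carrier)}
    (hβ : ∀ (g : K) (x : ∀ n, H n), Tendsto (fun n => ℓ ((x n : G)⁻¹ * g)) U (𝓝 0) →
      ∀ b, LimitRel τ U (fun n => α n (x n)) b (β g b)) : IsErgodicAction β := by
  refine Set.Subset.antisymm (fun b hb => ?_) ?_
  swap
  · rintro _ ⟨z, rfl⟩ h
    exact AlgHomClass.commutes (β h) z
  have hcl : IsClosed (Set.range (algebraMap ℂ B.carrier)) :=
    (algebraMap_isometry ℂ B.carrier).isClosedEmbedding.isClosed_range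
  rw [← hcl.closure_eq]
  refine Metric.mem_closure_iff.mpr fun ε' hε' => ?_
  -- Since `b'` moves by at most `2 * ε`, its transport to `A n` moves by at most `2 * (3 * ε) + ε`.
  -- Returning from the nearby scalar costs `2 * (7 * ε) + ε`, plus `ε` for `b'`: 16 in all.
  obtain ⟨ε, hε, hεε'⟩ : ∃ ε : ℝ, 0 < ε ∧ 20 * ε < ε' := ⟨ε' / 21, by positivity, by linarith⟩
  obtain ⟨b', l, hl, hbb'⟩ := exists_isLip_norm_sub_lt B b hε
  have hβb' : ∀ g, ‖β g b' - b'‖ ≤ 2 * ε := fun g => by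
    have h1 : ‖β g b' - β g b‖ = ‖b - b'‖ := by
      rw [← map_sub, StarAlgEquiv.norm_map, norm_sub_rev]
    have h2 := norm_sub_le_norm_sub_add_norm_sub (β g b') (β g b) b'
    rw [hb g] at h1 h2
    linarith
  choose d hdb hd using fun n => (τ n).isometry₂.exists_isLip_lift hl (lt_add_one l)
  set m : ℝ≥0 := l + 1 + (l + 1) with hm
  have hinv : ∀ᶠ n in (U : Filter ℕ), ∀ h : H n,
      ‖α n h ((τ n).π₁ (d n)) - (τ n).π₁ (d n)‖ ≤ 7 * ε := by
    -- For one sequence `x n` with limit `g`, `β g` almost fixes `b'` and tracks the action of `x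
    -- n`, which gives near invariance in `A n`.
    refine eventually_forall_of_forall_eventually fun x => ?_
    obtain ⟨g, -, hg⟩ := exists_tendsto_length (U := U) hℓ hℓc fun n => (x n : G)
    have hgK : g ∈ K := by
      rw [← SetLike.mem_coe, hK]; exact mem_limitSet_of_tendsto hg
    have hlip : ∀ n, IsLip (A n) m (α n (x n) ((τ n).π₁ (d n))) := fun n =>
      ((τ n).isometry₁.isLip (hd n)).aut (hαL n _)
    choose e hea he using fun n => (τ n).isometry₁.exists_isLip_lift (hlip n) (lt_add_one m)
    filter_upwards [(hβ ⟨g, hgK⟩ x hg b').norm_sub_le_of_isLip hτ (m + 1 + (m + 1)) hε,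
      eventually_norm_le_of_isLip hτ (m + 1 + (m + 1) + m) hε] with n h1 h2
    have k1 := h1 (d n) (e n) ((hd n).mono (by
      rw [add_assoc]; exact le_self_add)) (he n)
    rw [hdb, hea, sub_self, sub_self, norm_zero, norm_zero] at k1
    have k2 := (h2 _ ((he n).sub (hd n))).2
    have k3 := NonUnitalStarAlgHom.norm_apply_le (τ n).π₁ (e n - d n)
    rw [map_sub, hdb] at k2
    rw [map_sub, hea] at k3
    have k4 := norm_sub_le_norm_sub_add_norm_sub ((τ n).π₂ (e n)) (β ⟨g, hgK⟩ b') b'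
    have k5 := hβb' ⟨g, hgK⟩
    linarith
  obtain ⟨n, h1, h2⟩ := (hinv.and (eventually_norm_le_of_isLip hτ (m + 0) hε)).exists
  have : CompactSpace (H n) := isCompact_iff_compactSpace.mp (hH n).isCompact
  obtain ⟨z, hz⟩ := exists_norm_sub_algebraMap_le ((hα n).isStronglyContinuous hℓ hℓc) (herg n) h1
  have k1 := (h2 _ ((hd n).sub (IsLip.algebraMap z))).1
  have k2 := NonUnitalStarAlgHom.norm_apply_le (τ n).π₂ (d n - algebraMap ℂ _ z)
  rw [map_sub, AlgHomClass.commutes] at k1 k2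
  rw [hdb] at k2
  refine ⟨_, ⟨z, rfl⟩, ?_⟩
  rw [dist_eq_norm]
  have k3 := norm_sub_le_norm_sub_add_norm_sub b b' (algebraMap ℂ _ z)
  linarith

theorem isPropinquityClosed_ergodicClass (hℓ : IsLengthFunction ℓ) (hℓc : Continuous ℓ)
    (hconj : ∀ g h : G, ℓ (h * g * h⁻¹) = ℓ g) {𝒢 : Set (Subgroup G)}
    (h𝒢 : ∀ H ∈ 𝒢, IsClosed (H : Set G)) (h𝒢_closed : IsHausdorffClosed ℓ 𝒢)
    (hF : IsAdmissible F) (hF_finite : ∀ x y s t : ℝ≥0, F x y s t ≠ ⊤) :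
    IsPropinquityClosed (ergodicClass.{u} ℓ 𝒢 F) := by
  intro A B hA hlim
  -- At `k = 0` the bound is `∞`, which still provides a tunnel.
  have hsub : ∀ k : ℕ, ∃ n, ∃ τ : Tunnel (A n) B, τ.extent < (k : ℝ≥0∞)⁻¹ := fun k => by
    obtain ⟨n, hn⟩ := (hlim.eventually_lt_const
      (show 0 < (k : ℝ≥0∞)⁻¹ from ENNReal.inv_pos.mpr (ENNReal.natCast_ne_top k))).exists
    exact ⟨n, iInf_lt_iff.mp hn⟩
  choose n τ hτn using hsub
  choose H hH𝒢 α _ herg hα hαL using fun k => hA (n k)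
  let U : Ultrafilter ℕ := hyperfilter ℕ
  have hτ : Tendsto (fun k => (τ k).extent) U (𝓝 0) :=
    (tendsto_of_tendsto_of_tendsto_of_le_of_le tendsto_const_nhds
      ENNReal.tendsto_inv_nat_nhds_zero (fun _ => zero_le) fun k => (hτn k).le).mono_left
        Nat.hyperfilter_le_atTop
  have hH := fun k => h𝒢 _ (hH𝒢 k)
  obtain ⟨K, hK𝒢, hK⟩ := exists_mem_coe_eq_limitSet (U := U) hℓ hℓc h𝒢_closed hH𝒢
  obtain ⟨β, hβ⟩ := exists_limit_action hF hF_finite hℓ hℓc hconj hH hK hτ hα hαL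
  have hlip : ∀ (g : K) (b : selfAdjoint B.carrier) (l : ℝ≥0), B.L b < l →
      B.L (autSelfAdjoint (β g) b) ≤ l ∧ ‖(b : B.carrier) - β g b‖ ≤ l * ℓ g := by
    intro g b l hl
    obtain ⟨x, hx⟩ := exists_tendsto_of_mem_limitSet hℓc hH (hK ▸ g.2 : (g : G) ∈ limitSet ℓ H U)
    exact limit_action_lipschitz hℓ hτ hα hαL hx (hβ g x hx) hl
  have hβd : IsDominating ℓ B β :=
    (isDominating_iff hℓ).mpr fun a l hl h => (hlip h a l hl).2
  exact ⟨K, hK𝒢, β, hβd.isStronglyContinuous hℓ hℓc,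
    isErgodicAction_of_limit hℓ hℓc hH hK hτ hα hαL herg hβ, hβd,
    fun g b => ENNReal.le_of_forall_lt_coe_imp_le fun l hl => (hlip g b l hl).1⟩

end LimitAction

/-! ### The one-dimensional space -/

section Scalars

theorem exists_smul_one_of_selfAdjoint (a : selfAdjoint C(PUnit.{u + 1}, ℂ)) :
    ∃ t : ℝ, a = t • (1 : selfAdjoint C(PUnit.{u + 1}, ℂ)) := by
  have h1 : star ((a : C(PUnit, ℂ)) PUnit.unit) = (a : C(PUnit, ℂ)) PUnit.unit := by
    conv_rhs => rw [← a.2.star_eq]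
    rfl
  refine ⟨((a : C(PUnit, ℂ)) PUnit.unit).re, Subtype.ext (ContinuousMap.ext fun x => ?_)⟩
  rw [selfAdjoint.val_smul, selfAdjoint.val_one, ContinuousMap.smul_apply, ContinuousMap.one_apply]
  simpa using (Complex.conj_eq_iff_re.mp h1).symm

theorem exists_algebraMap_eq (a : C(PUnit.{u + 1}, ℂ)) :
    ∃ z : ℂ, algebraMap ℂ C(PUnit.{u + 1}, ℂ) z = a :=
  ⟨a PUnit.unit, ContinuousMap.ext fun _ => rfl⟩

/-- The one-dimensional C*-algebra with its only L-seminorm. -/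
def scalarSpace (F : ℝ≥0∞ → ℝ≥0∞ → ℝ≥0∞ → ℝ≥0∞ → ℝ≥0∞) : QQCMS.{u} F where
  carrier := C(PUnit.{u + 1}, ℂ)
  L := 0
  isLSeminorm :=
    have hs : Subsingleton (stateSpace C(PUnit.{u + 1}, ℂ)) := ⟨fun φ ψ =>
      Subtype.ext (DFunLike.ext _ _ fun a => by
        obtain ⟨z, rfl⟩ := exists_algebraMap_eq a
        rw [state_algebraMap, state_algebraMap])⟩
    { add_le _ _ := by simp
      smul_eq _ _ := by simp
      dense_dom := by simp
      jordan_mem_dom _ _ _ _ := by simp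
      lie_mem_dom _ _ _ _ := by simp
      eq_zero_iff a := by simpa using exists_smul_one_of_selfAdjoint a
      metrizes :=
        let m : MetricSpace (stateSpace C(PUnit.{u + 1}, ℂ)) :=
          { dist := fun _ _ => 0
            dist_self := fun _ => rfl
            dist_comm := fun _ _ => rfl
            dist_triangle := fun _ _ _ => by simp
            eq_of_dist_eq_zero := fun _ => Subsingleton.elim _ _ }
        ⟨m, Subsingleton.elim _ _, fun φ ψ => by
          rw [Subsingleton.elim ψ φ]
          rw [m.edist_dist]
          simp [mongeKantorovich]⟩
      quasi_leibniz _ _ _ _ := by simp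
      lsc := lowerSemicontinuous_const }

/-- On the scalars the trivial action of any group is ergodic, and its action seminorm is zero. -/
theorem nonempty_ergodicClass {G : Type*} [Group G] [TopologicalSpace G] (ℓ : G → ℝ≥0)
    {𝒢 : Set (Subgroup G)} (h𝒢 : 𝒢.Nonempty) (F : ℝ≥0∞ → ℝ≥0∞ → ℝ≥0∞ → ℝ≥0∞ → ℝ≥0∞) :
    (ergodicClass.{u} ℓ 𝒢 F).Nonempty := by
  obtain ⟨H, hH⟩ := h𝒢
  refine ⟨scalarSpace F, H, hH, 1, fun a => continuous_const, ?_, fun a => ?_, fun h a => le_rfl⟩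
  · refine Set.Subset.antisymm (fun a _ => exists_algebraMap_eq a) ?_
    rintro _ ⟨z, rfl⟩ h
    rfl
  · refine iSup₂_le fun h _ => ?_
    simp

end Scalars

end Propinquity

end

theorem mainTheorem5
    {G : Type*} [Group G] [TopologicalSpace G] [IsTopologicalGroup G] [CompactSpace G]
    (ℓ : G → NNReal) (hℓ : Propinquity.IsLengthFunction ℓ) (hℓ_cont : Continuous ℓ)
    (hℓ_conj : ∀ g h : G, ℓ (h * g * h⁻¹) = ℓ g)
    (𝒢 : Set (Subgroup G)) (h𝒢_nonempty : 𝒢.Nonempty)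
    (h𝒢_closed_subgroups : ∀ H ∈ 𝒢, IsClosed (H : Set G))
    (h𝒢_closed : Propinquity.IsHausdorffClosed ℓ 𝒢)
    (F : ENNReal → ENNReal → ENNReal → ENNReal → ENNReal) (hF : Propinquity.IsAdmissible F)
    (hF_finite : ∀ x y s t : NNReal, F x y s t ≠ ⊤) :
    (Propinquity.ergodicClass.{u} ℓ 𝒢 F).Nonempty ∧
      Propinquity.IsPropinquityClosed (Propinquity.ergodicClass.{u} ℓ 𝒢 F) := by
  exact ⟨Propinquity.nonempty_ergodicClass ℓ h𝒢_nonempty F,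
    Propinquity.isPropinquityClosed_ergodicClass hℓ hℓ_cont hℓ_conj h𝒢_closed_subgroups h𝒢_closed hF
      hF_finite⟩
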